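/- **Setting.** Let $\mathcal W\subset\mathbb R^d$ ($d\ge 1$) be closed, convex and contained in the unit ball, and let $\theta^*\in\mathcal W$ be unknown. The known link function $g:\mathbb R\to\mathbb R$ is, on $[-1,1]$, $G$-Lipschitz, continuously differentiable and bounded by $C$ in absolute value, and $g'\ge\mu>0$ on $(-1,1)$. In round $t=1,\dots,T$ a decision set $\mathcal X_t$ contained in the unit ball is presented (it may depend on the past), the learner plays $x_t\in\mathcal X_t$, and the reward $y_t=g(x_t^\top\theta^*)+\eta_t$ is observed, where $\eta_t\in[-1,1]$ has mean $0$ conditionally on the past and on $x_t$. With $x_{t,*}\in\operatorname{argmax}_{x\in\mathcal X_t} g(x^\top\theta^*)$, the regret is $\mathrm{Reg}_T=\sum_{t=1}^T \big(g(x_{t,*}^\top\theta^*)-g(x_t^\top\theta^*)\big)$. Let $\ell(a,b)=-ab+\int_0^a g$ and $\ell_t(\theta)=\ell(x_t^\top\theta,y_t)$, so that $\nabla\ell_t(\theta)=(g(x_t^\top\theta)-y_t)\,x_t$. **Algorithm** (inputs $\varepsilon,\delta,\alpha$, horizon $T$, step size $\zeta$, widths $\beta_t\ge 0$). Put $\sigma=6\sqrt{2\ln(3.75/\delta)}/\varepsilon$,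 $\Upsilon_t=\sigma\sqrt t\,(4\sqrt d+2\ln(2T/\alpha))$, $c_t=2\Upsilon_t$, $\bar V_0=\tilde V_0=0$, $\tilde u_0=\tilde\theta_0=\hat\theta_1=0$. In round $t$ play $x_t\in\operatorname{argmax}_{x\in\mathcal X_t}\big(\langle\tilde\theta_{t-1},x\rangle+\beta_{t-1}\sqrt{x^\top\tilde V_{t-1}^{-1}x}\big)$ (any $x_t\in\mathcal X_t$ if $\tilde V_{t-1}$ is not positive definite, in particular for $t=1$), and set $z_t=x_t^\top\hat\theta_t$. Draw $B_t$, a symmetric $d\times d$ matrix whose entries on and above the diagonal are i.i.d. $\mathcal N(0,\sigma^2)$, and $\xi_t\sim\mathcal N(0,\sigma^2 I_d)$, $r_t\sim\mathcal N(0,C^2\sigma^2I_d)$, independent of each other, of the past and of $(x_t,\eta_t)$. Update $$\bar V_t=\bar V_{t-1}+x_tx_t^\top+B_t,\quad \tilde V_t=\bar V_t+c_tI,\quad \tilde u_t=\tilde u_{t-1}+z_tx_t+\xi_t,\quad \tilde\theta_t=\tilde V_t^{-1}\tilde u_t,\quad \hat\theta_{t+1}=\Pi_{\mathcal W}\big(\hat\theta_t-\zeta(\nabla\ell_t(\hat\theta_t)+r_t)\big),$$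 where $\Pi_{\mathcal W}$ is the Euclidean projection onto $\mathcal W$. **Theorem.** There is an absolute $q\in\mathbb N$ such that the following holds. Fix $G,C,\mu,\varepsilon_0>0$, $\delta_0,\alpha_0\in(0,1)$ and $0<a_1\le a_2$. There is $b_0>0$ (depending only on these) such that for every $b_1\ge b_0$ there is $K>0$ (depending only on these and on $b_1$) such that, for all $1\le d<T$, $0<\varepsilon\le\varepsilon_0$, $0<\delta\le\delta_0$, $0<\alpha\le\alpha_0$, all $g$, $\mathcal W$, $\theta^*$ and environments as above, every step size with $$\frac{a_1}{C\sigma\sqrt{dT}}\le\zeta\le\frac{a_2}{C\sigma\sqrt{dT}}$$ and all widths with $$b_0\,\frac{C\sigma}{\mu}\sqrt{dT}\,\ln\frac{2T}{\alpha}\le\beta_t^2\le b_1\,\frac{C\sigma}{\mu}\sqrt{dT}\,\ln\frac{2T}{\alpha}\qquad(0\le t<T),$$ the regret of the algorithm satisfies, with probability at least $1-\alpha$ over the injected noise and the environment, $$\mathrm{Reg}_T\le K\,(1+\log T)^q\,\sqrt{\log\frac1\delta\,\log\frac1\alpha\,\log\frac Td}\;\frac{(dT)^{3/4}}{\varepsilon}.$$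 -/

import Mathlib

open MeasureTheory ProbabilityTheory
open scoped NNReal ENNReal Matrix

namespace LDPBandit

noncomputable section

/-- `ℝ^d` with the Euclidean norm. -/
abbrev Vec (d : ℕ) : Type := EuclideanSpace ℝ (Fin d)

/-! ### The generalized linear model -/

/-- The standing assumptions on the link function `g`: on `[-1,1]` it is `G`-Lipschitz,
continuously differentiable and bounded by `C` in absolute value, and `g' ≥ μ` on `(-1,1)`. -/
structure IsLink (g : ℝ → ℝ) (G C μ : ℝ) : Prop where
  lipschitz : ∀ a ∈ Set.Icc (-1 : ℝ) 1, ∀ b ∈ Set.Icc (-1 : ℝ) 1, |g a - g b| ≤ G * |a - b|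
  contDiffOn : ContDiffOn ℝ 1 g (Set.Icc (-1 : ℝ) 1)
  bounded : ∀ a ∈ Set.Icc (-1 : ℝ) 1, |g a| ≤ C
  le_deriv : ∀ a ∈ Set.Ioo (-1 : ℝ) 1, μ ≤ deriv g a

/-- The negative log-likelihood `ℓ(a, b) = -ab + m(a)`, where `m` is the integral of `g`. -/
def glmLoss (g : ℝ → ℝ) (a b : ℝ) : ℝ := -(a * b) + ∫ s in (0 : ℝ)..a, g s

/-- The gradient in `θ` of the loss `θ ↦ ℓ(⟨x, θ⟩, y)` (see `hasGradientWithinAt_glmLoss`). -/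
def lossGrad {d : ℕ} (g : ℝ → ℝ) (x : Vec d) (y : ℝ) (θ : Vec d) : Vec d :=
  (g (inner ℝ x θ) - y) • x

theorem hasDerivWithinAt_glmLoss {g : ℝ → ℝ} (hg : ContinuousOn g (Set.Icc (-1 : ℝ) 1))
    {a : ℝ} (ha : a ∈ Set.Icc (-1 : ℝ) 1) (b : ℝ) :
    HasDerivWithinAt (fun a => glmLoss g a b) (g a - b) (Set.Icc (-1 : ℝ) 1) a := by
  have h11 : (-1 : ℝ) ≤ 1 := by norm_num
  set G : ℝ → ℝ := Set.IccExtend h11 (fun s : Set.Icc (-1 : ℝ) 1 => g s) with hG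
  have hGc : Continuous G := (continuousOn_iff_continuous_domRestrict.mp hg).Icc_extend'
  have hGg : ∀ s ∈ Set.Icc (-1 : ℝ) 1, G s = g s := fun s hs => by
    rw [hG, Set.IccExtend_of_mem h11 _ hs]
  have h1 : HasDerivAt (fun a => -(a * b) + ∫ s in (0 : ℝ)..a, G s) (-(1 * b) + G a) a :=
    ((hasDerivAt_id a).mul_const b).neg.add
      (intervalIntegral.integral_hasDerivAt_right (hGc.intervalIntegrable _ _)
        hGc.stronglyMeasurable.stronglyMeasurableAtFilter hGc.continuousAt)
  have h2 : ∀ a ∈ Set.Icc (-1 : ℝ) 1,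
      glmLoss g a b = -(a * b) + ∫ s in (0 : ℝ)..a, G s := by
    intro a ha
    unfold glmLoss
    congr 1
    apply intervalIntegral.integral_congr
    intro s hs
    have h0 : (0 : ℝ) ∈ Set.Icc (-1 : ℝ) 1 := by constructor <;> norm_num
    exact (hGg s ((Set.uIcc_subset_Icc h0 ha) hs)).symm
  have h3 := (h1.hasDerivWithinAt (s := Set.Icc (-1 : ℝ) 1)).congr h2 (h2 a ha)
  rw [hGg a ha] at h3
  have h4 : -(1 * b) + g a = g a - b := by ring
  exact h4 ▸ h3

theorem hasGradientWithinAt_glmLoss {d : ℕ} {g : ℝ → ℝ}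
    (hg : ContinuousOn g (Set.Icc (-1 : ℝ) 1)) (x : Vec d) (y : ℝ) {θ : Vec d}
    (hθ : inner ℝ x θ ∈ Set.Icc (-1 : ℝ) 1) :
    HasGradientWithinAt (fun θ : Vec d => glmLoss g (inner ℝ x θ) y) (lossGrad g x y θ)
      {θ : Vec d | inner ℝ x θ ∈ Set.Icc (-1 : ℝ) 1} θ := by
  have h1 : HasFDerivWithinAt (fun θ : Vec d => inner ℝ x θ) (innerSL ℝ x)
      {θ : Vec d | inner ℝ x θ ∈ Set.Icc (-1 : ℝ) 1} θ :=
    (innerSL ℝ x).hasFDerivAt.hasFDerivWithinAt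
  have h2 := (hasDerivWithinAt_glmLoss hg hθ y).comp_hasFDerivWithinAt θ h1 (fun _ h => h)
  rw [hasGradientWithinAt_iff_hasFDerivWithinAt]
  have h3 : InnerProductSpace.toDual ℝ (Vec d) (lossGrad g x y θ)
      = (g (inner ℝ x θ) - y) • innerSL ℝ x := by
    ext v
    simp [lossGrad]
  rw [h3]
  exact h2

/-- The projection `Π_W(p)`: a point of `W` nearest to `p`. -/
def proj {d : ℕ} (W : Set (Vec d)) (p : Vec d) : Vec d :=
  Classical.epsilon fun q => q ∈ W ∧ ∀ w ∈ W, dist p q ≤ dist p w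

theorem proj_spec {d : ℕ} {W : Set (Vec d)} (hW : IsClosed W) (hne : W.Nonempty) (p : Vec d) :
    proj W p ∈ W ∧ ∀ w ∈ W, dist p (proj W p) ≤ dist p w := by
  have h : ∃ q, q ∈ W ∧ ∀ w ∈ W, dist p q ≤ dist p w := by
    obtain ⟨q, hq, h⟩ := hW.exists_infDist_eq_dist hne p
    exact ⟨q, hq, fun w hw => h ▸ Metric.infDist_le_dist_of_mem hw⟩
  exact Classical.epsilon_spec h

/-! ### The injected Gaussian noise -/

/-- The noise scale `σ = 6 √(2 ln(3.75/δ)) / ε`. -/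
def sigma (ε δ : ℝ) : ℝ := 6 * √(2 * Real.log (3.75 / δ)) / ε

/-- Coordinates of the noise injected by one user: the entries `(i, j)`, `i ≤ j`, of the
symmetric matrix `B_t`, then the coordinates of `ξ_t`, then those of `r_t`. -/
abbrev NoiseIdx (d : ℕ) : Type := {p : Fin d × Fin d // p.1 ≤ p.2} ⊕ (Fin d ⊕ Fin d)

/-- The joint law of `(B_t, ξ_t, r_t)`: all coordinates are independent centred Gaussians, of
variance `σ²` for `B_t` and `ξ_t` and of variance `C² σ²` for `r_t`. -/
def noiseLaw (d : ℕ) (σ C : ℝ) : Measure (NoiseIdx d → ℝ) :=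
  Measure.pi fun i => gaussianReal 0
    (Sum.elim (fun _ => (σ ^ 2).toNNReal)
      (Sum.elim (fun _ => (σ ^ 2).toNNReal) (fun _ => (C ^ 2 * σ ^ 2).toNNReal)) i)

/-- The symmetric matrix `B_t`. -/
def noiseB {d : ℕ} (w : NoiseIdx d → ℝ) : Matrix (Fin d) (Fin d) ℝ :=
  Matrix.of fun i j => w (Sum.inl ⟨(min i j, max i j), min_le_max⟩)

/-- The vector `ξ_t`. -/
def noiseXi {d : ℕ} (w : NoiseIdx d → ℝ) : Vec d :=
  WithLp.toLp 2 fun i => w (Sum.inr (Sum.inl i))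

/-- The vector `r_t`. -/
def noiseR {d : ℕ} (w : NoiseIdx d → ℝ) : Vec d :=
  WithLp.toLp 2 fun i => w (Sum.inr (Sum.inr i))

/-! ### The algorithm

Rounds are numbered from `0`: round `t` here is the round `t + 1` of a numbering from `1`.
The quantities `Vtilde t`, `utilde t`, `thetaTilde t` are those available after `t` rounds, and
`thetaHat t` is the online-gradient iterate that is used in round `t`. -/

/-- The inputs and the tuning of the algorithm. -/
structure Params (d : ℕ) where
  /-- number of rounds -/
  T : ℕ
  /-- privacy parameter -/
  ε : ℝ
  /-- privacy parameter -/
  δ : ℝ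
  /-- failure probability -/
  α : ℝ
  /-- bound on the link function -/
  C : ℝ
  /-- link function -/
  g : ℝ → ℝ
  /-- parameter domain -/
  W : Set (Vec d)
  /-- step size of online gradient descent -/
  ζ : ℝ
  /-- exploration widths -/
  β : ℕ → ℝ

/-- What happens in the successive rounds: played actions, rewards and injected noise. -/
structure Transcript (d : ℕ) where
  /-- the action `x_t` -/
  x : ℕ → Vec d
  /-- the reward `y_t` -/
  y : ℕ → ℝ
  /-- the injected noise `(B_t, ξ_t, r_t)` -/
  w : ℕ → NoiseIdx d → ℝ

variable {d : ℕ}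

/-- `σ` for the privacy parameters of the algorithm. -/
def Params.σ (p : Params d) : ℝ := sigma p.ε p.δ

/-- `Υ_t = σ √t (4 √d + 2 ln(2T/α))`. -/
def Params.upsilon (p : Params d) (t : ℕ) : ℝ :=
  p.σ * √(t : ℝ) * (4 * √(d : ℝ) + 2 * Real.log (2 * p.T / p.α))

/-- Noisy projected online gradient descent, started at `0`:
`θ̂_{t+1} = Π_W(θ̂_t - ζ (∇ℓ_t(θ̂_t) + r_t))`. -/
def thetaHat (p : Params d) (h : Transcript d) : ℕ → Vec d
  | 0 => 0
  | t + 1 => proj p.W (thetaHat p h t -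
      p.ζ • (lossGrad p.g (h.x t) (h.y t) (thetaHat p h t) + noiseR (h.w t)))

/-- `Ṽ_t = ∑_{s ≤ t} (x_s x_sᵀ + B_s) + c_t I` with `c_t = 2 Υ_t`. -/
def Vtilde (p : Params d) (h : Transcript d) (t : ℕ) : Matrix (Fin d) (Fin d) ℝ :=
  ∑ s ∈ Finset.range t, (Matrix.vecMulVec (h.x s).ofLp (h.x s).ofLp + noiseB (h.w s))
    + (2 * p.upsilon t) • (1 : Matrix (Fin d) (Fin d) ℝ)

/-- `ũ_t = ∑_{s ≤ t} (z_s x_s + ξ_s)` with the relabelled rewards `z_s = ⟨x_s, θ̂_s⟩`. -/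
def utilde (p : Params d) (h : Transcript d) (t : ℕ) : Vec d :=
  ∑ s ∈ Finset.range t,
    ((inner ℝ (h.x s) (thetaHat p h s) : ℝ) • h.x s + noiseXi (h.w s))

/-- `θ̃_t = Ṽ_t⁻¹ ũ_t`. -/
def thetaTilde (p : Params d) (h : Transcript d) (t : ℕ) : Vec d :=
  WithLp.toLp 2 ((Vtilde p h t)⁻¹ *ᵥ (utilde p h t).ofLp)

/-- `‖x‖_M = √(xᵀ M x)`. -/
def matNorm (M : Matrix (Fin d) (Fin d) ℝ) (x : Vec d) : ℝ := √(x.ofLp ⬝ᵥ (M *ᵥ x.ofLp))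

/-- The optimistic index `⟨θ̃_t, x⟩ + β_t ‖x‖_{Ṽ_t⁻¹}` of an action. -/
def ucb (p : Params d) (h : Transcript d) (t : ℕ) (x : Vec d) : ℝ :=
  inner ℝ (thetaTilde p h t) x + p.β t * matNorm (Vtilde p h t)⁻¹ x

/-! ### Runs of the algorithm -/

/-- `IsRun p θs P H D X η` says that the random transcript `X` arises from running the algorithm
for `p.T` rounds against an environment with true parameter `θs`, reward noise `η` and decision
sets `D`.  The σ-algebra `H t` contains the information available when the action of round `t`
is played.

The rule for choosing actions only makes sense when `Ṽ_t` is positive definite; otherwise (in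
particular in the first round, where the matrix is `0`) nothing is required of the action except
that it belongs to the decision set. -/
structure IsRun (p : Params d) (θs : Vec d) {Ω : Type*} {mΩ : MeasurableSpace Ω} (P : Measure Ω)
    (H : Filtration ℕ mΩ) (D : ℕ → Ω → Set (Vec d)) (X : Ω → Transcript d) (η : ℕ → Ω → ℝ) :
    Prop where
  /-- the decision sets lie in the unit ball -/
  norm_le_one : ∀ t < p.T, ∀ ω, ∀ x ∈ D t ω, ‖x‖ ≤ 1
  /-- the action is feasible -/
  action_mem : ∀ t < p.T, ∀ ω, (X ω).x t ∈ D t ω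
  /-- the action maximizes the optimistic index -/
  action_max : ∀ t < p.T, ∀ ω, (Vtilde p (X ω) t).PosDef →
    IsMaxOn (ucb p (X ω) t) (D t ω) ((X ω).x t)
  /-- the action depends on the available information only -/
  action_meas : ∀ t < p.T, Measurable[H t] fun ω => (X ω).x t
  /-- the reward -/
  reward_eq : ∀ t < p.T, ∀ ω, (X ω).y t = p.g (inner ℝ ((X ω).x t) θs) + η t ω
  /-- the reward noise is known after the round -/
  noise_meas : ∀ t < p.T, Measurable[H (t + 1)] (η t)
  /-- the reward noise takes values in `[-1, 1]` -/
  noise_abs_le : ∀ t < p.T, ∀ ω, |η t ω| ≤ 1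
  /-- the reward noise has conditional mean zero -/
  noise_mean : ∀ t < p.T, P[η t | H t] =ᵐ[P] 0
  /-- the injected noise is known after the round -/
  privacy_meas : ∀ t < p.T, Measurable[H (t + 1)] fun ω => (X ω).w t
  /-- the law of the injected noise -/
  privacy_law : ∀ t < p.T, P.map (fun ω => (X ω).w t) = noiseLaw d p.σ p.C
  /-- the injected noise is independent of the past and of the current action and reward -/
  privacy_indep : ∀ t < p.T,
    Indep (MeasurableSpace.comap (fun ω => (X ω).w t) inferInstance)
      (H t ⊔ MeasurableSpace.comap (η t) inferInstance) P

/-- The regret `∑_{t ≤ T} (g(⟨x_{t,*}, θ*⟩) - g(⟨x_t, θ*⟩))` of the actions in a transcript. -/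
def regret (p : Params d) (θs : Vec d) (xs : ℕ → Vec d) (h : Transcript d) : ℝ :=
  ∑ t ∈ Finset.range p.T, (p.g (inner ℝ (xs t) θs) - p.g (inner ℝ (h.x t) θs))

end

end LDPBandit

namespace LDPBandit

/-! ### Nets of the unit ball and quadratic forms -/

/-! The regret is the product of two quantities: the width of a confidence ellipsoid around
`thetaTilde`, and the sum over rounds of the norms of the played actions in the inverse design
matrix. Everything is deterministic on the event `GoodNoise`, which `IsRun.exists_goodNoise` obtains
from Chernoff bounds for adapted sums, with a net of the unit ball for the matrices `B_t`.

Width. By `Vtilde_mulVec_sub`, applying `Ṽ_t` to `θ̃_t - θ*` gives `∑ labelError s • x_s` plus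
`noiseError`. Cauchy–Schwarz in the dual norms (`abs_inner_inv_mulVec_le`) bounds the squared width
by `∑ labelError² + ‖noiseError‖² / (Υ_t / 4)`. The second term is `O(σ √(dT) L)`, `L = ln(2T/α)`,
because the shift `c_t I` dominates the accumulated `B_s` and leaves curvature `Υ_t / 4`. The first
term is the price of the relabelling. Since `g' ≥ μ`, the loss is strongly convex along `x_t`, so
the standard analysis of online gradient descent bounds the squared label errors. A step of order
`1/(Cσ√(dT))` balances `1/ζ` against `ζ ∑ ‖r_t‖²`, up to `L`, which gives `(C/μ) σ √(dT) L`. Hence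
the prescribed widths are valid.

Decay. On the good event `Ṽ_t` dominates `σ₀ I + ∑ x_s x_sᵀ` with the fixed `σ₀ = 6/ε₀`, so optimism
and the elliptical potential lemma bound the summed truncated widths by `√(dT)` up to logarithms.

The product has square of order `σ (dT)^{3/2}` up to logarithms, while the square of the claimed
rate carries `log(1/δ)/ε²`. The factor `log(T/d)` in the rate is harmless for `T ≥ 2d`; for `T ≤ 2d`
it may be as small as `1/T`, and then the trivial bound `2GT` already suffices. -/

theorem card_le_of_quarter_separated {d : ℕ} (s : Finset (Vec d)) (hs : ∀ c ∈ s, ‖c‖ ≤ 1)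
    (h : ∀ c ∈ s, ∀ e ∈ s, c ≠ e → 1 / 4 ≤ ‖c - e‖) : s.card ≤ 9 ^ d := by
  -- Volume comparison: the balls of radius `1/8` are disjoint and lie in the ball of radius `9/8`,
  -- and the ratio of radii is 9.
  set A : Set (Vec d) := ⋃ c ∈ s, Metric.ball c (1 / 8) with hA
  have hdisj : Set.Pairwise (s : Set (Vec d))
      (Function.onFun Disjoint fun c => Metric.ball c (1 / 8 : ℝ)) := by
    intro c hc e he hce
    refine Metric.ball_disjoint_ball ?_
    rw [dist_eq_norm]
    convert! h c hc e he hce using 1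
    norm_num
  have hsub : A ⊆ Metric.ball (0 : Vec d) (9 / 8) := by
    refine Set.iUnion₂_subset fun x hx => Metric.ball_subset_ball' ?_
    rw [dist_zero_right]
    linarith [hs x hx]
  have hvol : (s.card : ℝ≥0∞) * ENNReal.ofReal ((1 / 8 : ℝ) ^ d)
        * volume (Metric.ball (0 : Vec d) 1) ≤
      ENNReal.ofReal ((9 / 8 : ℝ) ^ d) * volume (Metric.ball (0 : Vec d) 1) :=
    calc
      _ = volume A := by
        rw [hA, measure_biUnion_finset hdisj fun c _ => measurableSet_ball]
        have h8 : (0 : ℝ) < 1 / 8 := by norm_num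
        simp only [volume.addHaar_ball_of_pos _ h8, finrank_euclideanSpace_fin,
          Finset.sum_const, nsmul_eq_mul, mul_assoc]
      _ ≤ volume (Metric.ball (0 : Vec d) (9 / 8)) := measure_mono hsub
      _ = _ := by
        have h8 : (0 : ℝ) < 9 / 8 := by norm_num
        simp only [volume.addHaar_ball_of_pos _ h8, finrank_euclideanSpace_fin]
  have hcard := (ENNReal.mul_le_mul_iff_left
    (Metric.measure_ball_pos volume _ zero_lt_one).ne' measure_ball_lt_top.ne).1 hvol
  have hreal : (s.card : ℝ) ≤ (9 : ℝ) ^ d := by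
    have := ENNReal.toReal_le_of_le_ofReal (by positivity) hcard
    rw [ENNReal.toReal_mul, ENNReal.toReal_natCast, ENNReal.toReal_ofReal (by positivity),
      div_pow, div_pow, one_pow, mul_one_div] at this
    exact (div_le_div_iff_of_pos_right (by positivity)).1 this
  exact_mod_cast hreal

/-- The unit ball of `ℝ^d` has a `1/4`-net with at most `9 ^ d` points. -/
theorem exists_quarter_net (d : ℕ) : ∃ s : Finset (Vec d), (∀ c ∈ s, ‖c‖ ≤ 1) ∧
    s.card ≤ 9 ^ d ∧ ∀ x : Vec d, ‖x‖ ≤ 1 → ∃ c ∈ s, ‖x - c‖ ≤ 1 / 4 := by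
  classical
  let Q : Finset (Vec d) → Prop := fun s => (∀ c ∈ s, ‖c‖ ≤ 1) ∧
    ∀ c ∈ s, ∀ e ∈ s, c ≠ e → 1 / 4 ≤ ‖c - e‖
  have hbdd : BddAbove {n | ∃ s, Q s ∧ s.card = n} := by
    refine ⟨9 ^ d, ?_⟩
    rintro _ ⟨s, hs, rfl⟩
    exact card_le_of_quarter_separated s hs.1 hs.2
  -- A separated set of maximal cardinality is a net: a point far from all of it could be added.
  obtain ⟨s, hs, hcard⟩ := Nat.sSup_mem (s := {n | ∃ s, Q s ∧ s.card = n})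
    ⟨0, ∅, by simp [Q], by simp⟩ hbdd
  refine ⟨s, hs.1, card_le_of_quarter_separated s hs.1 hs.2, fun x hx => ?_⟩
  by_contra! hfar
  have hxs : x ∉ s := fun hmem => by
    have := hfar x hmem
    rw [sub_self, norm_zero] at this
    norm_num at this
  have hins : Q (insert x s) := by
    refine ⟨fun c hc => ?_, fun c hc e he hce => ?_⟩
    · rcases Finset.mem_insert.1 hc with rfl | hc
      exacts [hx, hs.1 c hc]
    · rcases Finset.mem_insert.1 hc with rfl | hc' <;> rcases Finset.mem_insert.1 he with rfl | he'
      · exact absurd rfl hce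
      · exact (hfar e he').le
      · rw [norm_sub_rev]
        exact (hfar c hc').le
      · exact hs.2 c hc' e he' hce
  have := le_csSup hbdd ⟨insert x s, hins, rfl⟩
  rw [Finset.card_insert_of_notMem hxs] at this
  omega

/-- A symmetric bilinear form is controlled by its diagonal values on a `1/4`-net. -/
theorem abs_dotProduct_mulVec_le_of_net {d : ℕ} {s : Finset (Vec d)}
    (hs : ∀ c ∈ s, ‖c‖ ≤ 1) (hnet : ∀ x : Vec d, ‖x‖ ≤ 1 → ∃ c ∈ s, ‖x - c‖ ≤ 1 / 4)
    {B : Matrix (Fin d) (Fin d) ℝ} (hB : B.IsSymm) {M : ℝ}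
    (hM : ∀ c ∈ s, |c.ofLp ⬝ᵥ (B *ᵥ c.ofLp)| ≤ M) (x y : Vec d) :
    |x.ofLp ⬝ᵥ (B *ᵥ y.ofLp)| ≤ 2 * M * ‖x‖ * ‖y‖ := by
  set T : Vec d →L[ℝ] Vec d := Matrix.toEuclideanCLM (n := Fin d) (𝕜 := ℝ) B with hT
  have hinner : ∀ u v : Vec d, inner ℝ u (T v) = u.ofLp ⬝ᵥ (B *ᵥ v.ofLp) := fun u v => by
    rw [hT, Matrix.inner_toEuclideanCLM]
  have hsym : ∀ u v : Vec d, inner ℝ (T u) v = inner ℝ u (T v) := fun u v => by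
    rw [real_inner_comm, hinner, hinner, Matrix.dotProduct_mulVec, ← Matrix.mulVec_transpose, hB,
      dotProduct_comm]
  have hTsym : (T : Vec d →ₗ[ℝ] Vec d).IsSymmetric := fun u v => hsym u v
  have hM0 : 0 ≤ M := by
    obtain ⟨c, hc, -⟩ := hnet 0 (by simp)
    exact (abs_nonneg _).trans (hM c hc)
  have hunit : ∀ u : Vec d, ‖u‖ = 1 → |inner ℝ (T u) u| ≤ M + ‖T‖ / 2 := by
    intro u hu
    obtain ⟨c, hc, hcu⟩ := hnet u hu.le
    -- By symmetry of `T`, passing from `u` to the net point `c` costs at most `‖T‖ · (1/4) · 2 =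
    -- ‖T‖ / 2`.
    have hsplit : inner ℝ (T u) u = inner ℝ c (T c) + inner ℝ (T (u - c)) (u + c) := by
      rw [map_sub, inner_sub_left, inner_add_right, inner_add_right, hsym c u, hsym c c,
        hsym u c, hsym u u, ← hsym c u, real_inner_comm u (T c)]
      ring
    have hrest : |inner ℝ (T (u - c)) (u + c)| ≤ ‖T‖ / 2 := by
      refine (abs_real_inner_le_norm _ _).trans ?_
      have h1 : ‖T (u - c)‖ ≤ ‖T‖ * (1 / 4) :=
        (T.le_opNorm _).trans (mul_le_mul_of_nonneg_left hcu (norm_nonneg _))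
      have h2 : ‖u + c‖ ≤ 2 := (norm_add_le _ _).trans (by linarith [hs c hc])
      calc _ ≤ ‖T‖ * (1 / 4) * 2 := mul_le_mul h1 h2 (norm_nonneg _) (by positivity)
        _ = ‖T‖ / 2 := by ring
    rw [hsplit, hinner]
    exact (abs_add_le _ _).trans (add_le_add (hM c hc) hrest)
  -- The norm of a self-adjoint operator is the supremum of its Rayleigh quotients; absorbing `‖T‖ /
  -- 2` on the left produces the factor 2 of the conclusion.
  have hray : ‖T‖ ≤ M + ‖T‖ / 2 := by
    rw [ContinuousLinearMap.norm_eq_iSup_rayleighQuotient T hTsym]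
    refine ciSup_le fun u => ?_
    rw [← ContinuousLinearMap.norm_eq_iSup_rayleighQuotient T hTsym]
    by_cases hu : u = 0
    · subst hu
      simp only [ContinuousLinearMap.rayleighQuotient_apply_zero, abs_zero]
      positivity
    · have hu' : ‖u‖ ≠ 0 := norm_ne_zero_iff.2 hu
      have := hunit (‖u‖⁻¹ • u) (by rw [norm_smul, norm_inv, norm_norm, inv_mul_cancel₀ hu'])
      rw [← ContinuousLinearMap.rayleigh_smul T u (inv_ne_zero hu')]
      convert! this using 2
      have h1 : ‖‖u‖⁻¹ • u‖ = 1 := by rw [norm_smul, norm_inv, norm_norm, inv_mul_cancel₀ hu']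
      rw [ContinuousLinearMap.rayleighQuotient]
      simp [h1, ContinuousLinearMap.reApplyInnerSelf_apply]
  rw [← hinner]
  calc |inner ℝ x (T y)| ≤ ‖x‖ * ‖T y‖ := abs_real_inner_le_norm _ _
    _ ≤ ‖x‖ * (‖T‖ * ‖y‖) := mul_le_mul_of_nonneg_left (T.le_opNorm _) (norm_nonneg _)
    _ ≤ ‖x‖ * (2 * M * ‖y‖) := by
        have : ‖T‖ ≤ 2 * M := by linarith
        gcongr
    _ = _ := by ring

/-! ### Weighted norms and the elliptical potential -/

theorem inner_eq_dotProduct {d : ℕ} (x y : Vec d) : inner ℝ x y = x.ofLp ⬝ᵥ y.ofLp := by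
  rw [EuclideanSpace.inner_eq_star_dotProduct, dotProduct_comm]
  simp

theorem dotProduct_vecMulVec_mulVec {d : ℕ} (v y : Vec d) :
    y.ofLp ⬝ᵥ (Matrix.vecMulVec v.ofLp v.ofLp *ᵥ y.ofLp) = (inner ℝ v y) ^ 2 := by
  rw [inner_eq_dotProduct, Matrix.vecMulVec_mulVec, dotProduct_smul]
  simp only [MulOpposite.smul_eq_mul_unop, MulOpposite.unop_op]
  rw [dotProduct_comm y.ofLp, sq]

theorem matNorm_inv_sq {d : ℕ} {A : Matrix (Fin d) (Fin d) ℝ} (hA : A.PosDef) (x : Vec d) :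
    matNorm A⁻¹ x ^ 2 = x.ofLp ⬝ᵥ (A⁻¹ *ᵥ x.ofLp) := by
  rw [matNorm, Real.sq_sqrt]
  exact hA.inv.posSemidef.dotProduct_mulVec_nonneg x.ofLp

theorem mulVec_inv_mulVec {d : ℕ} {A : Matrix (Fin d) (Fin d) ℝ} (hA : A.PosDef)
    (v : Fin d → ℝ) : A *ᵥ (A⁻¹ *ᵥ v) = v := by
  rw [Matrix.mulVec_mulVec, Matrix.mul_nonsing_inv _ ((Matrix.isUnit_iff_isUnit_det _).1 hA.isUnit),
    Matrix.one_mulVec]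

theorem dotProduct_mulVec_comm {d : ℕ} {A : Matrix (Fin d) (Fin d) ℝ} (hA : A.IsHermitian)
    (u v : Fin d → ℝ) : u ⬝ᵥ (A *ᵥ v) = (A *ᵥ u) ⬝ᵥ v := by
  have hT : Aᵀ = A := by simpa using hA.eq
  rw [Matrix.dotProduct_mulVec, ← Matrix.mulVec_transpose, hT]

/-- The confidence bound for a regularized least-squares estimate with biased responses `a s` and
an additional perturbation `e`. -/
theorem abs_inner_inv_mulVec_le {d : ℕ} {A : Matrix (Fin d) (Fin d) ℝ} (hA : A.PosDef)
    {ι : Type*} (I : Finset ι) (x : ι → Vec d) (a : ι → ℝ) (e : Vec d) {lam : ℝ} (hlam : 0 < lam)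
    (hAge : ∀ y : Vec d, ∑ s ∈ I, (inner ℝ (x s) y) ^ 2 + lam * ‖y‖ ^ 2 ≤
      y.ofLp ⬝ᵥ (A *ᵥ y.ofLp)) (u v : Vec d) (hu : A *ᵥ u.ofLp = (∑ s ∈ I, a s • x s + e).ofLp) :
    |inner ℝ u v| ≤ √(∑ s ∈ I, a s ^ 2 + ‖e‖ ^ 2 / lam) * matNorm A⁻¹ v := by
  -- The dual vector: `⟨u, v⟩ = ⟨A u, y⟩`, and the `A`-norm of `y` is the `A⁻¹`-norm of `v`.
  set y : Vec d := WithLp.toLp 2 (A⁻¹ *ᵥ v.ofLp) with hy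
  have hyA : y.ofLp ⬝ᵥ (A *ᵥ y.ofLp) = matNorm A⁻¹ v ^ 2 := by
    rw [matNorm_inv_sq hA, hy, mulVec_inv_mulVec hA, dotProduct_comm]
  have hb : inner ℝ u v = ∑ s ∈ I, a s * inner ℝ (x s) y + inner ℝ e y := by
    have : inner ℝ u v = inner ℝ (∑ s ∈ I, a s • x s + e) y := by
      rw [inner_eq_dotProduct, inner_eq_dotProduct, ← hu, ← dotProduct_mulVec_comm hA.1, hy,
        mulVec_inv_mulVec hA]
    rw [this, inner_add_left, sum_inner]
    simp only [real_inner_smul_left]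
  set S := ∑ s ∈ I, a s ^ 2
  set R := ∑ s ∈ I, (inner ℝ (x s) y) ^ 2
  have hS : 0 ≤ S := Finset.sum_nonneg fun _ _ => sq_nonneg _
  have hR : 0 ≤ R := Finset.sum_nonneg fun _ _ => sq_nonneg _
  have hcs1 : (∑ s ∈ I, a s * inner ℝ (x s) y) ^ 2 ≤ S * R :=
    Finset.sum_mul_sq_le_sq_mul_sq _ _ _
  have h1 : |∑ s ∈ I, a s * inner ℝ (x s) y| ≤ √S * √R := by
    rw [← Real.sqrt_mul hS]
    exact Real.abs_le_sqrt hcs1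
  have h2 : |inner ℝ e y| ≤ (‖e‖ / √lam) * (√lam * ‖y‖) := by
    have := Real.sqrt_pos.2 hlam
    refine (abs_real_inner_le_norm e y).trans (le_of_eq ?_)
    field_simp
  have h3 : √S * √R + (‖e‖ / √lam) * (√lam * ‖y‖) ≤
      √(S + ‖e‖ ^ 2 / lam) * √(R + lam * ‖y‖ ^ 2) := by
    rw [← Real.sqrt_mul (x := S + ‖e‖ ^ 2 / lam) (by positivity)]
    refine Real.le_sqrt_of_sq_le ?_
    have e1 : S + ‖e‖ ^ 2 / lam = √S ^ 2 + (‖e‖ / √lam) ^ 2 := by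
      rw [Real.sq_sqrt hS, div_pow, Real.sq_sqrt hlam.le]
    have e2 : R + lam * ‖y‖ ^ 2 = √R ^ 2 + (√lam * ‖y‖) ^ 2 := by
      rw [Real.sq_sqrt hR, mul_pow, Real.sq_sqrt hlam.le]
    rw [e1, e2]
    nlinarith [sq_nonneg (√S * (√lam * ‖y‖) - (‖e‖ / √lam) * √R)]
  rw [hb]
  calc _ ≤ |∑ s ∈ I, a s * inner ℝ (x s) y| + |inner ℝ e y| := abs_add_le _ _
    _ ≤ _ := add_le_add h1 h2
    _ ≤ _ := h3
    _ ≤ √(S + ‖e‖ ^ 2 / lam) * √(matNorm A⁻¹ v ^ 2) := by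
        gcongr
        rw [← hyA]
        exact hAge y
    _ = _ := by rw [Real.sqrt_sq (show 0 ≤ matNorm A⁻¹ v from Real.sqrt_nonneg _)]

/-- Evaluate the form of `U` at `A⁻¹v - U⁻¹v`: its nonnegativity bounds `2 vᵀA⁻¹v` by `vᵀU⁻¹v` plus
the `U`-form of `A⁻¹v`, and the latter is at most `vᵀA⁻¹v` by hypothesis. -/
theorem dotProduct_inv_mulVec_anti {d : ℕ} {A U : Matrix (Fin d) (Fin d) ℝ} (hA : A.PosDef)
    (hU : U.PosDef) (h : ∀ y : Fin d → ℝ, y ⬝ᵥ (U *ᵥ y) ≤ y ⬝ᵥ (A *ᵥ y)) (v : Fin d → ℝ) :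
    v ⬝ᵥ (A⁻¹ *ᵥ v) ≤ v ⬝ᵥ (U⁻¹ *ᵥ v) := by
  have hp := hU.posSemidef.dotProduct_mulVec_nonneg (A⁻¹ *ᵥ v - U⁻¹ *ᵥ v)
  have h1 := h (A⁻¹ *ᵥ v)
  rw [mulVec_inv_mulVec hA] at h1
  have h2 : (U⁻¹ *ᵥ v) ⬝ᵥ (U *ᵥ (A⁻¹ *ᵥ v)) = (A⁻¹ *ᵥ v) ⬝ᵥ v := by
    rw [dotProduct_mulVec_comm hU.1, mulVec_inv_mulVec hU, dotProduct_comm]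
  simp only [star_trivial, Matrix.mulVec_sub, sub_dotProduct, dotProduct_sub,
    mulVec_inv_mulVec hU, h2] at hp
  rw [dotProduct_comm v, dotProduct_comm v]
  linarith

/-- The regularized Gram matrix of the first `n` vectors. -/
def gram {d : ℕ} (lam : ℝ) (x : ℕ → Vec d) (n : ℕ) : Matrix (Fin d) (Fin d) ℝ :=
  lam • (1 : Matrix (Fin d) (Fin d) ℝ) +
    ∑ s ∈ Finset.range n, Matrix.vecMulVec (x s).ofLp (x s).ofLp

theorem dotProduct_gram_mulVec {d : ℕ} (lam : ℝ) (x : ℕ → Vec d) (n : ℕ) (y : Vec d) :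
    y.ofLp ⬝ᵥ (gram lam x n *ᵥ y.ofLp) =
      ∑ s ∈ Finset.range n, (inner ℝ (x s) y) ^ 2 + lam * ‖y‖ ^ 2 := by
  rw [gram, Matrix.add_mulVec, dotProduct_add, Matrix.sum_mulVec, dotProduct_sum,
    Matrix.smul_mulVec, Matrix.one_mulVec, dotProduct_smul, ← inner_eq_dotProduct,
    real_inner_self_eq_norm_sq, add_comm, smul_eq_mul]
  simp only [dotProduct_vecMulVec_mulVec]

theorem isHermitian_gram {d : ℕ} (lam : ℝ) (x : ℕ → Vec d) (n : ℕ) :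
    (gram lam x n).IsHermitian := by
  ext i j
  simp [gram, Matrix.sum_apply, Matrix.vecMulVec_apply, Matrix.one_apply, eq_comm, mul_comm]

theorem posDef_gram {d : ℕ} {lam : ℝ} (hlam : 0 < lam) (x : ℕ → Vec d) (n : ℕ) :
    (gram lam x n).PosDef := by
  refine Matrix.PosDef.of_dotProduct_mulVec_pos (isHermitian_gram _ _ _) fun y hy => ?_
  have := dotProduct_gram_mulVec lam x n (WithLp.toLp 2 y)
  simp only [star_trivial] at this ⊢
  rw [this]
  have hy' : 0 < ‖(WithLp.toLp 2 y : Vec d)‖ := norm_pos_iff.2 (by simpa using hy)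
  have : 0 ≤ ∑ s ∈ Finset.range n, (inner ℝ (x s) (WithLp.toLp 2 y : Vec d)) ^ 2 :=
    Finset.sum_nonneg fun _ _ => sq_nonneg _
  positivity

/-- The matrix determinant lemma for a rank-one update; it makes the logarithms in the potential
lemma telescope. -/
theorem det_gram_succ {d : ℕ} {lam : ℝ} (hlam : 0 < lam) (x : ℕ → Vec d) (n : ℕ) :
    (gram lam x (n + 1)).det =
      (gram lam x n).det * (1 + (x n).ofLp ⬝ᵥ ((gram lam x n)⁻¹ *ᵥ (x n).ofLp)) := by
  have h : gram lam x (n + 1) = gram lam x n +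
      Matrix.replicateCol Unit (x n).ofLp * Matrix.replicateRow Unit (x n).ofLp := by
    rw [gram, Finset.sum_range_succ, ← add_assoc, ← gram, Matrix.vecMulVec_eq Unit]
  rw [h, Matrix.det_add_replicateCol_mul_replicateRow (posDef_gram hlam x n).det_pos.ne'.isUnit]
  congr 1
  rw [Matrix.det_unique, Matrix.add_apply, Matrix.one_apply_eq, Matrix.mul_assoc,
    ← Matrix.replicateCol_mulVec, Matrix.replicateRow_mul_replicateCol_apply]

/-- Each eigenvalue is at most the trace. This is cruder than the inequality of arithmetic and
geometric means, but only costs a factor `d` inside a logarithm. -/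
theorem det_gram_le {d : ℕ} {lam : ℝ} (hlam : 0 < lam) (x : ℕ → Vec d) (n : ℕ)
    (hx : ∀ s < n, ‖x s‖ ≤ 1) : (gram lam x n).det ≤ (d * lam + n) ^ d := by
  have hpd := posDef_gram hlam x n
  have htr : (gram lam x n).trace ≤ d * lam + n := by
    have hv : ∀ s, (Matrix.vecMulVec (x s).ofLp (x s).ofLp).trace = ‖x s‖ ^ 2 := fun s => by
      rw [Matrix.trace_vecMulVec, ← inner_eq_dotProduct, real_inner_self_eq_norm_sq]
    rw [gram, Matrix.trace_add, Matrix.trace_smul, Matrix.trace_one, Matrix.trace_sum,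
      Fintype.card_fin, smul_eq_mul, mul_comm]
    simp only [hv]
    refine add_le_add le_rfl ?_
    calc ∑ s ∈ Finset.range n, ‖x s‖ ^ 2 ≤ ∑ s ∈ Finset.range n, (1 : ℝ) :=
          Finset.sum_le_sum fun s hs =>
            pow_le_one₀ (norm_nonneg _) (hx s (Finset.mem_range.1 hs))
      _ = n := by simp
  have h1 := hpd.1.det_eq_prod_eigenvalues
  have h2 := hpd.1.trace_eq_sum_eigenvalues
  simp only [RCLike.ofReal_real_eq_id, id] at h1 h2
  rw [h1]
  calc ∏ i, hpd.1.eigenvalues i ≤ ∏ _i : Fin d, ((d : ℝ) * lam + n) := by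
        refine Finset.prod_le_prod (fun i _ => (hpd.eigenvalues_pos i).le) fun i _ => ?_
        refine le_trans ?_ htr
        rw [h2]
        exact Finset.single_le_sum (fun j _ => (hpd.eigenvalues_pos j).le) (Finset.mem_univ i)
    _ = _ := by simp

/-- The elliptical potential lemma. -/
theorem sum_log_one_add_le {d : ℕ} {lam : ℝ} (hlam : 0 < lam) (x : ℕ → Vec d) (n : ℕ)
    (hx : ∀ s < n, ‖x s‖ ≤ 1) :
    ∑ s ∈ Finset.range n, Real.log (1 + (x s).ofLp ⬝ᵥ ((gram lam x s)⁻¹ *ᵥ (x s).ofLp)) ≤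
      d * Real.log (d + n / lam) := by
  have hdet : ∑ s ∈ Finset.range n,
      Real.log (1 + (x s).ofLp ⬝ᵥ ((gram lam x s)⁻¹ *ᵥ (x s).ofLp)) =
      Real.log (gram lam x n).det - Real.log (gram lam x 0).det := by
    rw [← Finset.sum_range_sub (fun n => Real.log (gram lam x n).det)]
    refine Finset.sum_congr rfl fun s _ => ?_
    have hnn : 0 ≤ (x s).ofLp ⬝ᵥ ((gram lam x s)⁻¹ *ᵥ (x s).ofLp) :=
      (posDef_gram hlam x s).inv.posSemidef.dotProduct_mulVec_nonneg (x s).ofLp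
    rw [det_gram_succ hlam, Real.log_mul (posDef_gram hlam x s).det_pos.ne' (by positivity)]
    ring
  have h0 : (gram lam x 0).det = lam ^ d := by
    rw [gram, Finset.range_zero, Finset.sum_empty, add_zero, Matrix.det_smul, Matrix.det_one,
      Fintype.card_fin, mul_one]
  rcases Nat.eq_zero_or_pos d with rfl | hd
  · rw [hdet]
    simp
  have hd' : (0 : ℝ) < d := by exact_mod_cast hd
  have hsplit : (d : ℝ) + n / lam = (d * lam + n) / lam := by field_simp
  have hpos : 0 < (d : ℝ) * lam + n := by positivity
  rw [hdet, h0, Real.log_pow, hsplit, Real.log_div hpos.ne' hlam.ne', mul_sub]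
  refine sub_le_sub_right ?_ _
  rw [← Real.log_pow]
  exact Real.log_le_log (posDef_gram hlam x n).det_pos (det_gram_le hlam x n hx)

/-- With `m = min 1 u`, `log (1 + m) ≥ m / (1 + m) ≥ m / 2`. The truncation allows a regularization
as small as a constant, for which the potential may exceed 1. -/
theorem min_one_le_two_mul_log {u : ℝ} (hu : 0 ≤ u) : min 1 u ≤ 2 * Real.log (1 + u) := by
  have hmin : 0 ≤ min 1 u := le_min zero_le_one hu
  have h1 : Real.log (1 + min 1 u) ≤ Real.log (1 + u) :=
    Real.log_le_log (by positivity) (by linarith [min_le_right 1 u])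
  have h2 := Real.one_sub_inv_le_log_of_pos (x := 1 + min 1 u) (by positivity)
  have h3 : min 1 u / 2 ≤ 1 - (1 + min 1 u)⁻¹ := by
    have : 1 - (1 + min 1 u)⁻¹ = min 1 u / (1 + min 1 u) := by field_simp; ring
    rw [this]
    exact div_le_div_of_nonneg_left hmin (by positivity) (by linarith [min_le_left 1 u])
  linarith

/-! ### Exponential tail bounds for adapted sums -/

/-- Integrating out a variable that is independent of a σ-algebra. -/
theorem lintegral_comp_prodMk_of_indep {Ω : Type*} {m mΩ : MeasurableSpace Ω}
    {P : Measure Ω} [IsProbabilityMeasure P] (hm : m ≤ mΩ) {β γ : Type*} [MeasurableSpace β] [MeasurableSpace γ] {Y : Ω → β} {W : Ω → γ}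
    (hY : Measurable[m] Y) (hW : Measurable W)
    (hind : Indep (MeasurableSpace.comap W inferInstance) m P) {h : β × γ → ℝ≥0∞}
    (hh : Measurable h) :
    ∫⁻ ω, h (Y ω, W ω) ∂P = ∫⁻ ω, ∫⁻ w, h (Y ω, w) ∂(P.map W) ∂P := by
  have hY' : Measurable Y := hY.mono hm le_rfl
  have hYW : IndepFun Y W P :=
    (IndepFun_iff_Indep _ _ _).2 (indep_of_indep_of_le_left hind.symm hY.comap_le)
  have hmap := (indepFun_iff_map_prod_eq_prod_map_map hY'.aemeasurable hW.aemeasurable).1 hYW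
  have : IsProbabilityMeasure (P.map W) := Measure.isProbabilityMeasure_map hW.aemeasurable
  have : IsProbabilityMeasure (P.map Y) := Measure.isProbabilityMeasure_map hY'.aemeasurable
  calc _ = ∫⁻ z, h z ∂(P.map fun ω => (Y ω, W ω)) :=
        (lintegral_map hh (hY'.prodMk hW)).symm
    _ = ∫⁻ y, ∫⁻ w, h (y, w) ∂(P.map W) ∂(P.map Y) := by
        rw [hmap, lintegral_prod _ hh.aemeasurable]
    _ = _ := lintegral_map hh.lintegral_prod_right' hY'

section Tails

variable {Ω : Type*} {mΩ : MeasurableSpace Ω} {P : Measure Ω}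

/-- Chernoff's bound for a sum whose exponential moments grow by a subgaussian factor at
each step. -/
theorem measureReal_le_sum_le_exp [IsProbabilityMeasure P] (n : ℕ) (f : ℕ → Ω → ℝ)
    (hf : ∀ s < n, Measurable (f s)) (v : ℕ → ℝ) {V u X : ℝ}
    (hstep : ∀ lam : ℝ, ∀ s < n,
      ∫⁻ ω, ENNReal.ofReal (Real.exp (lam * ∑ r ∈ Finset.range s, f r ω) *
        Real.exp (lam * f s ω)) ∂P ≤
      ENNReal.ofReal (Real.exp (lam ^ 2 * v s / 2)) *
        ∫⁻ ω, ENNReal.ofReal (Real.exp (lam * ∑ r ∈ Finset.range s, f r ω)) ∂P)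
    (hv : ∑ s ∈ Finset.range n, v s ≤ V) (hV : 0 < V) (hu0 : 0 ≤ u)
    (hu : 2 * V * X ≤ u ^ 2) :
    P.real {ω | u ≤ ∑ s ∈ Finset.range n, f s ω} ≤ Real.exp (-X) := by
  have hmgf : ∀ lam : ℝ, ∀ k ≤ n,
      ∫⁻ ω, ENNReal.ofReal (Real.exp (lam * ∑ r ∈ Finset.range k, f r ω)) ∂P ≤
        ENNReal.ofReal (Real.exp (lam ^ 2 * (∑ s ∈ Finset.range k, v s) / 2)) := by
    intro lam k
    induction k with
    | zero => simp
    | succ k ih =>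
      intro hk
      calc _ = ∫⁻ ω, ENNReal.ofReal (Real.exp (lam * ∑ r ∈ Finset.range k, f r ω) *
              Real.exp (lam * f k ω)) ∂P := by
            refine lintegral_congr fun ω => ?_
            rw [Finset.sum_range_succ, mul_add, Real.exp_add]
        _ ≤ _ := hstep lam k (by omega)
        _ ≤ ENNReal.ofReal (Real.exp (lam ^ 2 * v k / 2)) * ENNReal.ofReal
              (Real.exp (lam ^ 2 * (∑ s ∈ Finset.range k, v s) / 2)) := by
            gcongr
            exact ih (by omega)
        _ = _ := by
            rw [← ENNReal.ofReal_mul (Real.exp_pos _).le, ← Real.exp_add, Finset.sum_range_succ]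
            congr 2
            ring
  -- The minimizer of `λ² V / 2 - λ u`, with minimal value `-u² / (2V)`.
  set lam := u / V
  have hlam : 0 ≤ lam := div_nonneg hu0 hV.le
  have hmeas : Measurable fun ω => ∑ s ∈ Finset.range n, f s ω :=
    Finset.measurable_fun_sum _ fun s hs => hf s (Finset.mem_range.1 hs)
  have hmarkov := mul_meas_ge_le_lintegral (μ := P)
    (f := fun ω => ENNReal.ofReal (Real.exp (lam * ∑ r ∈ Finset.range n, f r ω)))
    (by fun_prop) (ENNReal.ofReal (Real.exp (lam * u)))
  have hsub : {ω | u ≤ ∑ s ∈ Finset.range n, f s ω} ⊆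
      {ω | ENNReal.ofReal (Real.exp (lam * u)) ≤
        ENNReal.ofReal (Real.exp (lam * ∑ r ∈ Finset.range n, f r ω))} := fun ω hω =>
    ENNReal.ofReal_le_ofReal (Real.exp_le_exp.2 (mul_le_mul_of_nonneg_left hω hlam))
  have htot : ENNReal.ofReal (Real.exp (lam * u)) *
      P {ω | u ≤ ∑ s ∈ Finset.range n, f s ω} ≤ ENNReal.ofReal (Real.exp (lam ^ 2 * V / 2)) := by
    refine (mul_le_mul_right (measure_mono hsub) _).trans (hmarkov.trans
      ((hmgf lam n le_rfl).trans (ENNReal.ofReal_le_ofReal (Real.exp_le_exp.2 ?_))))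
    gcongr
  have hreal : Real.exp (lam * u) * P.real {ω | u ≤ ∑ s ∈ Finset.range n, f s ω} ≤
      Real.exp (lam ^ 2 * V / 2) := by
    have := ENNReal.toReal_mono ENNReal.ofReal_ne_top htot
    rwa [ENNReal.toReal_mul, ENNReal.toReal_ofReal (Real.exp_pos _).le,
      ENNReal.toReal_ofReal (Real.exp_pos _).le] at this
  have hexp : lam ^ 2 * V / 2 - lam * u ≤ -X := by
    have h1 : lam ^ 2 * V / 2 - lam * u = -(u ^ 2 / (2 * V)) := by
      simp only [lam]
      field_simp
      ring
    have h2 : X ≤ u ^ 2 / (2 * V) := by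
      rw [le_div_iff₀ (by positivity)]
      linarith
    linarith
  calc P.real {ω | u ≤ ∑ s ∈ Finset.range n, f s ω}
      ≤ Real.exp (lam ^ 2 * V / 2) / Real.exp (lam * u) := by
        rw [le_div_iff₀ (Real.exp_pos _)]
        linarith
    _ = Real.exp (lam ^ 2 * V / 2 - lam * u) := (Real.exp_sub _ _).symm
    _ ≤ _ := Real.exp_le_exp.2 hexp

theorem lintegral_exp_sum_gaussian {ι : Type*} [Fintype ι] (var : ι → ℝ≥0) (a : ι → ℝ) :
    ∫⁻ w, ENNReal.ofReal (Real.exp (∑ i, a i * w i))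
        ∂(Measure.pi fun i => gaussianReal 0 (var i)) =
      ENNReal.ofReal (Real.exp (∑ i, a i ^ 2 * var i / 2)) := by
  have hprod : ∀ w : ι → ℝ, Real.exp (∑ i, a i * w i) = ∏ i, Real.exp (a i * w i) :=
    fun w => Real.exp_sum _ _
  simp only [hprod]
  have hint : Integrable (fun w : ι → ℝ => ∏ i, Real.exp (a i * w i))
      (Measure.pi fun i => gaussianReal 0 (var i)) :=
    Integrable.fintype_prod (f := fun i x => Real.exp (a i * x))
      fun i => integrable_exp_mul_gaussianReal (a i)
  rw [← ofReal_integral_eq_lintegral_ofReal hint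
    (Filter.Eventually.of_forall fun w => Finset.prod_nonneg fun i _ => (Real.exp_pos _).le),
    integral_fintype_prod_eq_prod (fun i x => Real.exp (a i * x)), Real.exp_sum]
  congr 1
  refine Finset.prod_congr rfl fun i _ => ?_
  have := mgf_gaussianReal (p := gaussianReal 0 (var i)) (X := id) Measure.map_id (a i)
  rw [mgf] at this
  simp only [id] at this
  rw [this]
  congr 1
  ring

/-- Tail bound for predictable linear combinations of independent Gaussian vectors. -/
theorem measureReal_gaussian_sum_ge_le [IsProbabilityMeasure P] {H : Filtration ℕ mΩ}
    {ι : Type*} [Fintype ι] {var : ι → ℝ≥0} (n : ℕ) {W : ℕ → Ω → ι → ℝ}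
    (hWm : ∀ s < n, Measurable[H (s + 1)] (W s))
    (hWlaw : ∀ s < n, P.map (W s) = Measure.pi fun i => gaussianReal 0 (var i))
    (hWind : ∀ s < n, Indep (MeasurableSpace.comap (W s) inferInstance) (H s) P)
    (a : ℕ → Ω → ι → ℝ) (ha : ∀ s < n, Measurable[H s] (a s)) (v : ℕ → ℝ)
    (hav : ∀ s < n, ∀ ω, ∑ i, a s ω i ^ 2 * var i ≤ v s) {V u X : ℝ}
    (hv : ∑ s ∈ Finset.range n, v s ≤ V) (hV : 0 < V) (hu0 : 0 ≤ u) (hu : 2 * V * X ≤ u ^ 2) :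
    P.real {ω | u ≤ ∑ s ∈ Finset.range n, ∑ i, a s ω i * W s ω i} ≤ Real.exp (-X) := by
  have hf : ∀ s < n, Measurable[H (s + 1)] fun ω => ∑ i, a s ω i * W s ω i := by
    intro s hs
    have h1 := (ha s hs).mono (H.mono (Nat.le_succ s)) le_rfl
    have h2 := hWm s hs
    exact Finset.measurable_fun_sum _ fun i _ =>
      ((measurable_pi_apply i).comp h1).mul ((measurable_pi_apply i).comp h2)
  refine measureReal_le_sum_le_exp n (fun s ω => ∑ i, a s ω i * W s ω i)
    (fun s hs => (hf s hs).mono (H.le _) le_rfl) v ?_ hv hV hu0 hu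
  intro lam s hs
  set F : Ω → ℝ := fun ω =>
    Real.exp (lam * ∑ r ∈ Finset.range s, ∑ i, a r ω i * W r ω i) with hF
  have hFm : Measurable[H s] F := by
    refine Real.measurable_exp.comp (Measurable.const_mul ?_ lam)
    exact Finset.measurable_fun_sum _ fun r hr =>
      (hf r (by have := Finset.mem_range.1 hr; omega)).mono
        (H.mono (by have := Finset.mem_range.1 hr; omega)) le_rfl
  have hW : Measurable (W s) := (hWm s hs).mono (H.le _) le_rfl
  -- The exponential of the past and the coefficients are known at time `s`, so the fresh Gaussian
  -- vector is integrated out with both frozen.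
  have hmain := lintegral_comp_prodMk_of_indep (P := P) (H.le s) (Y := fun ω => (F ω, a s ω))
    (W := W s) (hFm.prodMk (ha s hs)) hW (hWind s hs)
    (h := fun z => ENNReal.ofReal (z.1.1 * Real.exp (lam * ∑ i, z.1.2 i * z.2 i)))
    (by fun_prop)
  rw [hmain, hWlaw s hs]
  have hFm' : Measurable F := hFm.mono (H.le s) le_rfl
  rw [← lintegral_const_mul _ hFm'.ennreal_ofReal]
  refine lintegral_mono fun ω => ?_
  have hF0 : 0 ≤ F ω := (Real.exp_pos _).le
  simp only [ENNReal.ofReal_mul hF0]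
  rw [lintegral_const_mul _ (by fun_prop), mul_comm]
  gcongr
  have hlin : ∀ w : ι → ℝ, lam * ∑ i, a s ω i * w i = ∑ i, (lam * a s ω i) * w i := fun w => by
    rw [Finset.mul_sum]
    exact Finset.sum_congr rfl fun i _ => (mul_assoc _ _ _).symm
  simp only [hlin]
  rw [lintegral_exp_sum_gaussian]
  refine ENNReal.ofReal_le_ofReal (Real.exp_le_exp.2 ?_)
  calc ∑ i, (lam * a s ω i) ^ 2 * (var i : ℝ) / 2
      = lam ^ 2 * (∑ i, a s ω i ^ 2 * var i) / 2 := by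
        rw [Finset.mul_sum, Finset.sum_div]
        exact Finset.sum_congr rfl fun i _ => by ring
    _ ≤ _ := by
        have := hav s hs ω
        gcongr

/-- The chord of the convex function `exp` over `[-y, y]`. The bound is affine in `x`, so
conditional mean zero removes the `sinh` term and leaves `cosh y ≤ exp (y² / 2)`, as in Hoeffding's
lemma. -/
theorem exp_mul_le_cosh_add {x y : ℝ} (hx : |x| ≤ 1) :
    Real.exp (x * y) ≤ Real.cosh y + x * Real.sinh y := by
  obtain ⟨h1, h2⟩ := abs_le.1 hx
  have hexp := convexOn_exp.2
  have hconv := @hexp y (Set.mem_univ y) (-y) (Set.mem_univ (-y))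
    ((1 + x) / 2) ((1 - x) / 2) (by linarith) (by linarith) (by ring)
  simp only [smul_eq_mul] at hconv
  have : (1 + x) / 2 * y + (1 - x) / 2 * -y = x * y := by ring
  rw [this] at hconv
  rw [Real.cosh_eq, Real.sinh_eq]
  linarith

/-- Tail bound for a predictable transform of bounded martingale differences. -/
theorem measureReal_martingale_sum_ge_le [IsProbabilityMeasure P] {H : Filtration ℕ mΩ}
    (n : ℕ) {η : ℕ → Ω → ℝ} (hηm : ∀ s < n, Measurable[H (s + 1)] (η s))
    (hη1 : ∀ s < n, ∀ ω, |η s ω| ≤ 1) (hη0 : ∀ s < n, P[η s | H s] =ᵐ[P] 0)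
    (a : ℕ → Ω → ℝ) (ha : ∀ s < n, Measurable[H s] (a s)) {b : ℝ}
    (hab : ∀ s < n, ∀ ω, |a s ω| ≤ b) {V u X : ℝ}
    (hv : n * b ^ 2 ≤ V) (hV : 0 < V) (hu0 : 0 ≤ u) (hu : 2 * V * X ≤ u ^ 2) :
    P.real {ω | u ≤ ∑ s ∈ Finset.range n, η s ω * a s ω} ≤ Real.exp (-X) := by
  have hf : ∀ s < n, Measurable[H (s + 1)] fun ω => η s ω * a s ω := fun s hs =>
    (hηm s hs).mul ((ha s hs).mono (H.mono (Nat.le_succ s)) le_rfl)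
  refine measureReal_le_sum_le_exp n (fun s ω => η s ω * a s ω)
    (fun s hs => (hf s hs).mono (H.le _) le_rfl) (fun _ => b ^ 2) ?_ (by simpa using hv)
    hV hu0 hu
  intro lam s hs
  set F : Ω → ℝ := fun ω =>
    Real.exp (lam * ∑ r ∈ Finset.range s, η r ω * a r ω) with hF
  have hFm : Measurable[H s] F := by
    refine Real.measurable_exp.comp (Measurable.const_mul ?_ lam)
    exact Finset.measurable_fun_sum _ fun r hr =>
      (hf r (by have := Finset.mem_range.1 hr; omega)).mono
        (H.mono (by have := Finset.mem_range.1 hr; omega)) le_rfl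
  have hFb : ∀ ω, F ω ≤ Real.exp (|lam| * (s * b)) := by
    intro ω
    refine Real.exp_le_exp.2 ((le_abs_self _).trans ?_)
    rw [abs_mul]
    refine mul_le_mul_of_nonneg_left ?_ (abs_nonneg _)
    refine (Finset.abs_sum_le_sum_abs _ _).trans ?_
    calc ∑ r ∈ Finset.range s, |η r ω * a r ω| ≤ ∑ r ∈ Finset.range s, b := by
          refine Finset.sum_le_sum fun r hr => ?_
          have hr' : r < n := by have := Finset.mem_range.1 hr; omega
          rw [abs_mul]
          calc |η r ω| * |a r ω| ≤ 1 * b :=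
                mul_le_mul (hη1 r hr' ω) (hab r hr' ω) (abs_nonneg _) zero_le_one
            _ = b := one_mul b
      _ = s * b := by simp
  set K : Ω → ℝ := fun ω => F ω * Real.sinh (lam * a s ω) with hK
  have hKm : Measurable[H s] K :=
    hFm.mul (Real.measurable_sinh.comp ((ha s hs).const_mul lam))
  have hKb : ∀ ω, ‖K ω‖ ≤ Real.exp (|lam| * (s * b)) * Real.sinh (|lam| * b) := by
    intro ω
    rw [hK, norm_mul, Real.norm_eq_abs, Real.norm_eq_abs, abs_of_pos (Real.exp_pos _)]
    refine mul_le_mul (hFb ω) ?_ (abs_nonneg _) (Real.exp_pos _).le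
    rw [Real.abs_sinh, Real.sinh_le_sinh, abs_mul]
    exact mul_le_mul_of_nonneg_left (hab s hs ω) (abs_nonneg _)
  have hηmeas : Measurable (η s) := (hηm s hs).mono (H.le _) le_rfl
  have hηint : Integrable (η s) P :=
    Integrable.of_bound hηmeas.aestronglyMeasurable 1
      (Filter.Eventually.of_forall fun ω => by simpa using hη1 s hs ω)
  -- `K` is known at time `s` and bounded, so it can be pulled out of the conditional expectation of
  -- `η s`.
  have hzero : ∫ ω, K ω * η s ω ∂P = 0 := by
    have h1 := condExp_stronglyMeasurable_mul_of_bound (H.le s) hKm.stronglyMeasurable hηint _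
      (Filter.Eventually.of_forall hKb)
    rw [← integral_condExp (H.le s)]
    have h2 : P[fun ω => K ω * η s ω | H s] =ᵐ[P] 0 := by
      refine h1.trans ?_
      filter_upwards [hη0 s hs] with ω hω
      simp [hω]
    rw [integral_congr_ae h2]
    simp
  have hFm' : Measurable F := hFm.mono (H.le s) le_rfl
  have hKm' : Measurable K := hKm.mono (H.le s) le_rfl
  have ham' : Measurable (a s) := (ha s hs).mono (H.le s) le_rfl
  have hFint : Integrable F P := Integrable.of_bound hFm'.aestronglyMeasurable _
    (Filter.Eventually.of_forall fun ω => by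
      rw [Real.norm_eq_abs, abs_of_pos (Real.exp_pos _)]
      exact hFb ω)
  have hKηint : Integrable (fun ω => K ω * η s ω) P :=
    Integrable.of_bound (hKm'.mul hηmeas).aestronglyMeasurable _
      (Filter.Eventually.of_forall fun ω => by
        rw [norm_mul]
        exact (mul_le_mul (hKb ω) (hη1 s hs ω) (norm_nonneg _)
          ((norm_nonneg _).trans (hKb ω))))
  have hpt : ∀ ω, F ω * Real.exp (lam * (η s ω * a s ω)) ≤
      Real.exp (lam ^ 2 * b ^ 2 / 2) * F ω + K ω * η s ω := by
    intro ω
    have h1 := exp_mul_le_cosh_add (y := lam * a s ω) (hη1 s hs ω)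
    have h2 : Real.cosh (lam * a s ω) ≤ Real.exp (lam ^ 2 * b ^ 2 / 2) := by
      refine (Real.cosh_le_exp_half_sq _).trans (Real.exp_le_exp.2 ?_)
      have : a s ω ^ 2 ≤ b ^ 2 := by
        rw [← sq_abs]
        exact pow_le_pow_left₀ (abs_nonneg _) (hab s hs ω) 2
      rw [mul_pow]
      gcongr
    have h3 : lam * (η s ω * a s ω) = η s ω * (lam * a s ω) := by ring
    rw [h3]
    calc _ ≤ F ω * (Real.exp (lam ^ 2 * b ^ 2 / 2) + η s ω * Real.sinh (lam * a s ω)) :=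
          mul_le_mul_of_nonneg_left (by linarith) (Real.exp_pos _).le
      _ = _ := by
          simp only [hK]
          ring
  have hGint : Integrable (fun ω => F ω * Real.exp (lam * (η s ω * a s ω))) P := by
    refine Integrable.mono' (g := fun ω => Real.exp (lam ^ 2 * b ^ 2 / 2) * F ω + K ω * η s ω)
      ((hFint.const_mul _).add hKηint)
      (hFm'.mul (by fun_prop)).aestronglyMeasurable (Filter.Eventually.of_forall fun ω => ?_)
    rw [Real.norm_eq_abs, abs_of_nonneg (mul_nonneg (Real.exp_pos _).le (Real.exp_pos _).le)]
    exact hpt ω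
  rw [← ofReal_integral_eq_lintegral_ofReal hGint (Filter.Eventually.of_forall fun ω =>
    mul_nonneg (Real.exp_pos _).le (Real.exp_pos _).le),
    ← ofReal_integral_eq_lintegral_ofReal hFint (Filter.Eventually.of_forall fun ω =>
      (Real.exp_pos _).le), ← ENNReal.ofReal_mul (Real.exp_pos _).le]
  refine ENNReal.ofReal_le_ofReal ?_
  calc _ ≤ ∫ ω, (Real.exp (lam ^ 2 * b ^ 2 / 2) * F ω + K ω * η s ω) ∂P :=
        integral_mono hGint ((hFint.const_mul _).add hKηint) hpt
    _ = _ := by rw [integral_add (hFint.const_mul _) hKηint, hzero, add_zero, integral_const_mul]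

end Tails

/-! ### Projected online gradient descent -/

theorem inner_sub_proj_le_zero {d : ℕ} {W : Set (Vec d)} (hW : IsClosed W) (hc : Convex ℝ W)
    (p : Vec d) {w : Vec d} (hw : w ∈ W) : inner ℝ (p - proj W p) (w - proj W p) ≤ 0 := by
  obtain ⟨hmem, hmin⟩ := proj_spec hW ⟨w, hw⟩ p
  refine (norm_eq_iInf_iff_real_inner_le_zero hc hmem).1 ?_ w hw
  have : Nonempty W := ⟨⟨w, hw⟩⟩
  refine le_antisymm (le_ciInf fun v => ?_) (ciInf_le ⟨0, ?_⟩ (⟨proj W p, hmem⟩ : W))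
  · simpa [dist_eq_norm] using hmin v v.2
  · rintro _ ⟨v, rfl⟩
    exact norm_nonneg _

/-- Add the variational inequalities at the two projections and apply Cauchy–Schwarz. The resulting
continuity of `proj` is what makes the iterates measurable. -/
theorem norm_proj_sub_proj_le {d : ℕ} {W : Set (Vec d)} (hW : IsClosed W) (hc : Convex ℝ W)
    (hne : W.Nonempty) (p q : Vec d) : ‖proj W p - proj W q‖ ≤ ‖p - q‖ := by
  have h1 := inner_sub_proj_le_zero hW hc p (proj_spec hW hne q).1
  have h2 := inner_sub_proj_le_zero hW hc q (proj_spec hW hne p).1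
  set a := proj W p
  set b := proj W q
  have h3 : ‖a - b‖ ^ 2 ≤ inner ℝ (p - q) (a - b) := by
    rw [← real_inner_self_eq_norm_sq]
    have : inner ℝ (p - q) (a - b) - inner ℝ (a - b) (a - b) =
        -inner ℝ (p - a) (b - a) - inner ℝ (q - b) (a - b) := by
      simp only [inner_sub_left, inner_sub_right]
      ring
    linarith
  have h4 := real_inner_le_norm (p - q) (a - b)
  rcases (norm_nonneg (a - b)).eq_or_lt with h0 | h0
  · rw [← h0]
    exact norm_nonneg _
  · nlinarith

theorem norm_proj_sub_le {d : ℕ} {W : Set (Vec d)} (hW : IsClosed W) (hc : Convex ℝ W)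
    (p : Vec d) {w : Vec d} (hw : w ∈ W) : ‖proj W p - w‖ ^ 2 ≤ ‖p - w‖ ^ 2 := by
  have h1 := inner_sub_proj_le_zero hW hc p hw
  have h2 : p - w = (p - proj W p) - (w - proj W p) := by abel
  have h3 : ‖proj W p - w‖ = ‖w - proj W p‖ := norm_sub_rev _ _
  rw [h3, h2, norm_sub_sq_real (p - proj W p)]
  nlinarith [sq_nonneg ‖p - proj W p‖]

theorem continuous_proj {d : ℕ} {W : Set (Vec d)} (hW : IsClosed W) (hc : Convex ℝ W)
    (hne : W.Nonempty) : Continuous (proj W) :=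
  (LipschitzWith.of_dist_le_mul (K := 1) fun p q => by
    simpa [dist_eq_norm] using norm_proj_sub_proj_le hW hc hne p q).continuous

theorem inner_mem_Icc {d : ℕ} {x θ : Vec d} (hx : ‖x‖ ≤ 1) (hθ : ‖θ‖ ≤ 1) :
    inner ℝ x θ ∈ Set.Icc (-1 : ℝ) 1 := by
  rw [Set.mem_Icc, ← abs_le]
  exact (abs_real_inner_le_norm x θ).trans (mul_le_one₀ hx (norm_nonneg _) hθ)

theorem IsLink.mul_sq_le {g : ℝ → ℝ} {G C μ : ℝ} (hg : IsLink g G C μ) {a b : ℝ}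
    (ha : a ∈ Set.Icc (-1 : ℝ) 1) (hb : b ∈ Set.Icc (-1 : ℝ) 1) :
    μ * (a - b) ^ 2 ≤ (g a - g b) * (a - b) := by
  have hdiff : DifferentiableOn ℝ g (interior (Set.Icc (-1 : ℝ) 1)) :=
    (hg.contDiffOn.differentiableOn one_ne_zero).mono interior_subset
  have key : ∀ u ∈ Set.Icc (-1 : ℝ) 1, ∀ v ∈ Set.Icc (-1 : ℝ) 1, u ≤ v →
      μ * (v - u) ≤ g v - g u :=
    (convex_Icc (-1 : ℝ) 1).mul_sub_le_image_sub_of_le_deriv hg.contDiffOn.continuousOn hdiff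
      fun x hx => hg.le_deriv x (by rwa [interior_Icc] at hx)
  rcases le_total a b with h | h
  · nlinarith [key a ha b hb h]
  · nlinarith [key b hb a ha h]

/-- Transfers a one-sided bound on the gap of inner products to rewards: monotonicity of `g` settles
`a ≤ b`, the Lipschitz bound settles `b ≤ a`. -/
theorem IsLink.sub_le {g : ℝ → ℝ} {G C μ : ℝ} (hg : IsLink g G C μ) (hG : 0 ≤ G) (hμ : 0 ≤ μ)
    {a b m : ℝ} (ha : a ∈ Set.Icc (-1 : ℝ) 1) (hb : b ∈ Set.Icc (-1 : ℝ) 1) (hm : 0 ≤ m)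
    (hab : a - b ≤ m) : g a - g b ≤ G * m := by
  rcases le_total a b with h | h
  · have h1 := hg.mul_sq_le ha hb
    rcases h.eq_or_lt with rfl | h
    · rw [sub_self]
      positivity
    · have : g a - g b ≤ 0 := by
        by_contra! hpos
        nlinarith [sq_nonneg (a - b)]
      exact this.trans (by positivity)
  · have h1 := (le_abs_self _).trans (hg.lipschitz a ha b hb)
    rw [abs_of_nonneg (sub_nonneg.2 h)] at h1
    exact h1.trans (mul_le_mul_of_nonneg_left hab hG)

section OGD

variable {d : ℕ} {p : Params d} {θs : Vec d} {h : Transcript d}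

theorem norm_thetaHat_le (hW : IsClosed p.W) (hW1 : ∀ θ ∈ p.W, ‖θ‖ ≤ 1) (hθ : θs ∈ p.W) (t : ℕ) :
    ‖thetaHat p h t‖ ≤ 1 := by
  cases t with
  -- The starting point 0 need not belong to `W`, so only later iterates get their bound from the
  -- projection.
  | zero => simp [thetaHat]
  | succ t => exact hW1 _ (proj_spec hW ⟨θs, hθ⟩ _).1

theorem norm_thetaHat_sub_le (hW : IsClosed p.W) (hW1 : ∀ θ ∈ p.W, ‖θ‖ ≤ 1) (hθ : θs ∈ p.W)
    (t : ℕ) : ‖thetaHat p h t - θs‖ ≤ 2 :=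
  (norm_sub_le _ _).trans (by linarith [norm_thetaHat_le (h := h) hW hW1 hθ t, hW1 θs hθ])

/-- The error of the relabelled reward: `⟨x_s, θ̂_s⟩ - ⟨x_s, θ*⟩`. -/
noncomputable def labelError (p : Params d) (θs : Vec d) (h : Transcript d) (s : ℕ) : ℝ :=
  inner ℝ (h.x s) (thetaHat p h s) - inner ℝ (h.x s) θs

theorem labelError_eq (p : Params d) (θs : Vec d) (h : Transcript d) (s : ℕ) :
    labelError p θs h s = inner ℝ (h.x s) (thetaHat p h s - θs) := by
  rw [labelError, inner_sub_right]

theorem abs_labelError_le (hW : IsClosed p.W) (hW1 : ∀ θ ∈ p.W, ‖θ‖ ≤ 1) (hθ : θs ∈ p.W) {s : ℕ}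
    (hx : ‖h.x s‖ ≤ 1) : |labelError p θs h s| ≤ 2 := by
  rw [labelError_eq]
  refine (abs_real_inner_le_norm _ _).trans ?_
  have := norm_thetaHat_sub_le (h := h) hW hW1 hθ s
  calc _ ≤ 1 * 2 := mul_le_mul hx this (norm_nonneg _) zero_le_one
    _ = 2 := one_mul 2

/-- The regret bound of noisy online gradient descent, in terms of the labelling errors. -/
theorem sum_labelError_sq_le {G C μ : ℝ} (hC : 0 ≤ C) (hg : IsLink p.g G C μ)
    (hW : IsClosed p.W) (hWc : Convex ℝ p.W) (hW1 : ∀ θ ∈ p.W, ‖θ‖ ≤ 1) (hθ : θs ∈ p.W)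
    (hζ : 0 < p.ζ) {n : ℕ} (hx : ∀ t < n, ‖h.x t‖ ≤ 1) {η : ℕ → ℝ} (hη : ∀ t < n, |η t| ≤ 1)
    (hy : ∀ t < n, h.y t = p.g (inner ℝ (h.x t) θs) + η t) :
    2 * p.ζ * (μ * ∑ t ∈ Finset.range n, labelError p θs h t ^ 2) ≤
      1 + 2 * p.ζ * ∑ t ∈ Finset.range n, η t * labelError p θs h t
        - 2 * p.ζ * ∑ t ∈ Finset.range n, inner ℝ (noiseR (h.w t)) (thetaHat p h t - θs)
        + p.ζ ^ 2 * ∑ t ∈ Finset.range n, (2 * (2 * C + 1) ^ 2 + 2 * ‖noiseR (h.w t)‖ ^ 2) := by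
  have hstep : ∀ t < n, ‖thetaHat p h (t + 1) - θs‖ ^ 2 ≤ ‖thetaHat p h t - θs‖ ^ 2
      - 2 * p.ζ * (μ * labelError p θs h t ^ 2) + 2 * p.ζ * (η t * labelError p θs h t)
      - 2 * p.ζ * inner ℝ (noiseR (h.w t)) (thetaHat p h t - θs)
      + p.ζ ^ 2 * (2 * (2 * C + 1) ^ 2 + 2 * ‖noiseR (h.w t)‖ ^ 2) := by
    intro t ht
    set e := thetaHat p h t - θs with he
    set r := noiseR (h.w t)
    set c := p.g (inner ℝ (h.x t) (thetaHat p h t)) - h.y t with hc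
    have hz := inner_mem_Icc (hx t ht) (norm_thetaHat_le (h := h) hW hW1 hθ t)
    have hs := inner_mem_Icc (hx t ht) (hW1 θs hθ)
    have hproj : ‖thetaHat p h (t + 1) - θs‖ ^ 2 ≤ ‖e - p.ζ • (c • h.x t + r)‖ ^ 2 := by
      refine (norm_proj_sub_le hW hWc _ hθ).trans (le_of_eq ?_)
      congr 2
      rw [he, lossGrad]
      abel
    have hc1 : |c| ≤ 2 * C + 1 := by
      rw [hc, hy t ht]
      have h1 := abs_le.1 (hg.bounded _ hz)
      have h2 := abs_le.1 (hg.bounded _ hs)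
      have h3 := abs_le.1 (hη t ht)
      rw [abs_le]
      constructor <;> linarith
    have hsq : ‖c • h.x t + r‖ ^ 2 ≤ 2 * (2 * C + 1) ^ 2 + 2 * ‖r‖ ^ 2 := by
      have h1 : ‖c • h.x t‖ ≤ 2 * C + 1 := by
        rw [norm_smul, Real.norm_eq_abs]
        calc _ ≤ (2 * C + 1) * 1 := mul_le_mul hc1 (hx t ht) (norm_nonneg _) (by positivity)
          _ = _ := mul_one _
      have h2 := norm_add_le (c • h.x t) r
      have h3 := norm_nonneg (c • h.x t)
      have h4 := norm_nonneg r
      have h5 : ‖c • h.x t + r‖ ^ 2 ≤ (‖c • h.x t‖ + ‖r‖) ^ 2 :=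
        pow_le_pow_left₀ (norm_nonneg _) h2 2
      have h6 : ‖c • h.x t‖ ^ 2 ≤ (2 * C + 1) ^ 2 := pow_le_pow_left₀ h3 h1 2
      nlinarith [sq_nonneg (‖c • h.x t‖ - ‖r‖)]
    -- Strong monotonicity of `g` turns the gradient term into the squared label error, up to a
    -- martingale difference.
    have hin : μ * labelError p θs h t ^ 2 - η t * labelError p θs h t ≤
        c * inner ℝ (h.x t) e := by
      have h1 := hg.mul_sq_le hz hs
      rw [← labelError_eq, hc, hy t ht]
      rw [← labelError] at h1
      nlinarith
    have hexp : ‖e - p.ζ • (c • h.x t + r)‖ ^ 2 = ‖e‖ ^ 2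
        - 2 * p.ζ * (c * inner ℝ (h.x t) e + inner ℝ r e)
        + p.ζ ^ 2 * ‖c • h.x t + r‖ ^ 2 := by
      rw [norm_sub_sq_real, norm_smul, mul_pow, Real.norm_eq_abs, sq_abs, inner_smul_right,
        inner_add_right, inner_smul_right, real_inner_comm (h.x t) e, real_inner_comm r e]
      ring
    have h1 : p.ζ ^ 2 * ‖c • h.x t + r‖ ^ 2 ≤
        p.ζ ^ 2 * (2 * (2 * C + 1) ^ 2 + 2 * ‖r‖ ^ 2) :=
      mul_le_mul_of_nonneg_left hsq (sq_nonneg _)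
    have h2 := mul_le_mul_of_nonneg_left hin (by positivity : 0 ≤ 2 * p.ζ)
    linarith
  -- Telescoping of the one-step inequality; the constant 1 bounds the initial squared distance `‖0
  -- - θ*‖²`.
  have hsum : ∀ k ≤ n, ‖thetaHat p h k - θs‖ ^ 2
      + 2 * p.ζ * (μ * ∑ t ∈ Finset.range k, labelError p θs h t ^ 2) ≤
      1 + 2 * p.ζ * ∑ t ∈ Finset.range k, η t * labelError p θs h t
        - 2 * p.ζ * ∑ t ∈ Finset.range k, inner ℝ (noiseR (h.w t)) (thetaHat p h t - θs)
        + p.ζ ^ 2 * ∑ t ∈ Finset.range k, (2 * (2 * C + 1) ^ 2 + 2 * ‖noiseR (h.w t)‖ ^ 2) := by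
    intro k
    induction k with
    | zero =>
      intro _
      simp only [thetaHat, zero_sub, norm_neg, Finset.range_zero, Finset.sum_empty, mul_zero,
        add_zero, sub_zero]
      exact pow_le_one₀ (norm_nonneg _) (hW1 θs hθ)
    | succ k ih =>
      intro hk
      simp only [Finset.sum_range_succ, mul_add]
      have h1 := ih (by omega)
      have h2 := hstep k (by omega)
      simp only [mul_add] at h2 h1
      linarith
  have := hsum n le_rfl
  nlinarith [sq_nonneg ‖thetaHat p h n - θs‖]

end OGD

/-! ### Measurability of the iterates -/

section Meas

variable {d : ℕ} {p : Params d} {θs : Vec d} {Ω : Type*} {mΩ : MeasurableSpace Ω}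
  {P : Measure Ω} {H : Filtration ℕ mΩ} {D : ℕ → Ω → Set (Vec d)} {X : Ω → Transcript d}
  {η : ℕ → Ω → ℝ}

theorem IsRun.norm_x_le (hrun : IsRun p θs P H D X η) {t : ℕ} (ht : t < p.T) (ω : Ω) :
    ‖(X ω).x t‖ ≤ 1 :=
  hrun.norm_le_one t ht ω _ (hrun.action_mem t ht ω)

theorem measurable_noiseR : Measurable (noiseR (d := d)) := by
  unfold noiseR
  fun_prop

theorem IsRun.measurable_thetaHat (hrun : IsRun p θs P H D X η) {G C μ : ℝ}
    (hg : IsLink p.g G C μ) (hW : IsClosed p.W) (hWc : Convex ℝ p.W)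
    (hW1 : ∀ θ ∈ p.W, ‖θ‖ ≤ 1) (hθ : θs ∈ p.W) (t : ℕ) (ht : t ≤ p.T) :
    Measurable[H t] fun ω => thetaHat p (X ω) t := by
  have h11 : (-1 : ℝ) ≤ 1 := by norm_num
  -- The link is only known to be continuous on `[-1, 1]`. All its arguments lie there, so a
  -- continuous extension replaces it.
  set g' : ℝ → ℝ := Set.IccExtend h11 (fun s : Set.Icc (-1 : ℝ) 1 => p.g s) with hg'
  have hgc : Continuous g' :=
    (continuousOn_iff_continuous_domRestrict.mp hg.contDiffOn.continuousOn).Icc_extend'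
  have hgg : ∀ s ∈ Set.Icc (-1 : ℝ) 1, p.g s = g' s := fun s hs => by
    rw [hg', Set.IccExtend_of_mem h11 _ hs]
  induction t with
  | zero => exact measurable_const
  | succ t ih =>
    have hlt : t < p.T := by omega
    have hmono : H t ≤ H (t + 1) := H.mono (Nat.le_succ t)
    have hθm := (ih (by omega)).mono hmono le_rfl
    have hxm := (hrun.action_meas t hlt).mono hmono le_rfl
    have hηm := hrun.noise_meas t hlt
    have hrm := measurable_noiseR.comp (hrun.privacy_meas t hlt)
    have heq : (fun ω => thetaHat p (X ω) (t + 1)) = fun ω => proj p.W (thetaHat p (X ω) t -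
        p.ζ • ((g' (inner ℝ ((X ω).x t) (thetaHat p (X ω) t)) -
          (g' (inner ℝ ((X ω).x t) θs) + η t ω)) • (X ω).x t + noiseR ((X ω).w t))) := by
      funext ω
      rw [thetaHat, lossGrad, hrun.reward_eq t hlt ω,
        hgg _ (inner_mem_Icc (hrun.norm_x_le hlt ω) (norm_thetaHat_le hW hW1 hθ t)),
        hgg _ (inner_mem_Icc (hrun.norm_x_le hlt ω) (hW1 θs hθ))]
    rw [heq]
    refine (continuous_proj hW hWc ⟨θs, hθ⟩).measurable.comp ?_
    have h1 := hgc.measurable.comp (hxm.inner hθm)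
    have h2 := hgc.measurable.comp (hxm.inner (measurable_const (a := θs)))
    exact hθm.sub ((((h1.sub (h2.add hηm)).smul hxm).add hrm).const_smul p.ζ)

end Meas

/-! ### The good event -/

/-- The coefficients of the quadratic form `B ↦ cᵀ B c` in the entries of `B` on and above the
diagonal. -/
noncomputable def quadCoeff {d : ℕ} (c : Vec d) (q : {p : Fin d × Fin d // p.1 ≤ p.2}) : ℝ :=
  ∑ ij : Fin d × Fin d with
    (⟨(min ij.1 ij.2, max ij.1 ij.2), min_le_max⟩ : {p : Fin d × Fin d // p.1 ≤ p.2}) = q,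
    c ij.1 * c ij.2

theorem dotProduct_noiseB_mulVec {d : ℕ} (c : Vec d) (w : NoiseIdx d → ℝ) :
    c.ofLp ⬝ᵥ (noiseB w *ᵥ c.ofLp) = ∑ q, quadCoeff c q * w (Sum.inl q) := by
  have h1 : c.ofLp ⬝ᵥ (noiseB w *ᵥ c.ofLp) = ∑ ij : Fin d × Fin d, c ij.1 * c ij.2 *
      w (Sum.inl ⟨(min ij.1 ij.2, max ij.1 ij.2), min_le_max⟩) := by
    rw [Fintype.sum_prod_type]
    simp only [dotProduct, Matrix.mulVec, noiseB, Matrix.of_apply, Finset.mul_sum]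
    exact Finset.sum_congr rfl fun i _ => Finset.sum_congr rfl fun j _ => by ring
  rw [h1, ← Finset.sum_fiberwise (g := fun ij : Fin d × Fin d =>
    (⟨(min ij.1 ij.2, max ij.1 ij.2), min_le_max⟩ : {p : Fin d × Fin d // p.1 ≤ p.2}))]
  refine Finset.sum_congr rfl fun q _ => ?_
  rw [quadCoeff, Finset.sum_mul]
  refine Finset.sum_congr rfl fun ij hij => ?_
  rw [(Finset.mem_filter.1 hij).2]

/-- Each independent entry collects at most two index pairs, so Cauchy–Schwarz loses a factor 2
against `∑ (c_i c_j)² = ‖c‖⁴`. Thus `cᵀ B c` has variance at most `2σ²`. -/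
theorem sum_quadCoeff_sq_le {d : ℕ} {c : Vec d} (hc : ‖c‖ ≤ 1) : ∑ q, quadCoeff c q ^ 2 ≤ 2 := by
  have hq : ∀ q, quadCoeff c q ^ 2 ≤ 2 * ∑ ij : Fin d × Fin d with
      (⟨(min ij.1 ij.2, max ij.1 ij.2), min_le_max⟩ : {p : Fin d × Fin d // p.1 ≤ p.2}) = q,
      (c ij.1 * c ij.2) ^ 2 := by
    intro q
    refine sq_sum_le_card_mul_sum_sq.trans ?_
    refine mul_le_mul_of_nonneg_right ?_ (Finset.sum_nonneg fun _ _ => sq_nonneg _)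
    have hsub : (Finset.univ.filter fun ij : Fin d × Fin d =>
        (⟨(min ij.1 ij.2, max ij.1 ij.2), min_le_max⟩ : {p : Fin d × Fin d // p.1 ≤ p.2}) = q) ⊆
        {(q.1.1, q.1.2), (q.1.2, q.1.1)} := by
      rintro ⟨i, j⟩ hij
      have := (Finset.mem_filter.1 hij).2
      subst this
      rcases le_total i j with h | h <;> simp [h]
    exact_mod_cast (Finset.card_le_card hsub).trans Finset.card_le_two
  calc _ ≤ ∑ q, 2 * ∑ ij : Fin d × Fin d with
      (⟨(min ij.1 ij.2, max ij.1 ij.2), min_le_max⟩ : {p : Fin d × Fin d // p.1 ≤ p.2}) = q,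
      (c ij.1 * c ij.2) ^ 2 := Finset.sum_le_sum fun q _ => hq q
    _ = 2 * ∑ ij : Fin d × Fin d, (c ij.1 * c ij.2) ^ 2 := by
        rw [← Finset.mul_sum, Finset.sum_fiberwise]
    _ = 2 * (‖c‖ ^ 2) ^ 2 := by
        rw [Fintype.sum_prod_type, EuclideanSpace.real_norm_sq_eq, sq (∑ i, _),
          Finset.sum_mul_sum]
        simp only [mul_pow]
    _ ≤ 2 := by
        have := pow_le_one₀ (n := 2) (norm_nonneg c) hc
        have := pow_le_one₀ (n := 2) (sq_nonneg ‖c‖) this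
        linarith

/-- The variances of the coordinates of the injected noise. -/
noncomputable def noiseVar (d : ℕ) (σ C : ℝ) : NoiseIdx d → ℝ≥0 :=
  Sum.elim (fun _ => (σ ^ 2).toNNReal)
    (Sum.elim (fun _ => (σ ^ 2).toNNReal) (fun _ => (C ^ 2 * σ ^ 2).toNNReal))

/-- The deviation bounds for the injected noise and the reward noise on which the regret analysis
rests; `L` is the logarithmic factor and `N` a net of the unit ball. -/
structure GoodNoise {d : ℕ} (p : Params d) (θs : Vec d) (N : Finset (Vec d)) (L : ℝ)
    (h : Transcript d) (η : ℕ → ℝ) : Prop where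
  xi : ∀ t ∈ Finset.Ico 1 p.T, ∀ i, |∑ s ∈ Finset.range t, noiseXi (h.w s) i| ≤ p.σ * √(6 * t * L)
  r : ∀ t ∈ Finset.range p.T, ∀ i, |noiseR (h.w t) i| ≤ p.C * p.σ * √(6 * L)
  quad : ∀ t ∈ Finset.Ico 1 p.T, ∀ c ∈ N,
    |∑ s ∈ Finset.range t, c.ofLp ⬝ᵥ (noiseB (h.w s) *ᵥ c.ofLp)| ≤ p.σ * √(12 * t * (d + L))
  drift : -∑ s ∈ Finset.range p.T, inner ℝ (noiseR (h.w s)) (thetaHat p h s - θs) ≤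
    p.C * p.σ * √(24 * p.T * L)
  mart : ∑ s ∈ Finset.range p.T, η s * labelError p θs h s ≤ √(24 * p.T * L)

section Run

variable {d : ℕ} {p : Params d} {θs : Vec d} {Ω : Type*} {mΩ : MeasurableSpace Ω}
  {P : Measure Ω} {H : Filtration ℕ mΩ} {D : ℕ → Ω → Set (Vec d)} {X : Ω → Transcript d}
  {η : ℕ → Ω → ℝ}

theorem IsRun.measureReal_noise_ge_le [IsProbabilityMeasure P] (hrun : IsRun p θs P H D X η)
    {n : ℕ} (hn : n ≤ p.T) (a : ℕ → Ω → NoiseIdx d → ℝ) (ha : ∀ s < n, Measurable[H s] (a s))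
    (v : ℕ → ℝ) (hav : ∀ s < n, ∀ ω, ∑ i, a s ω i ^ 2 * (noiseVar d p.σ p.C i : ℝ) ≤ v s)
    {V u Y : ℝ} (hv : ∑ s ∈ Finset.range n, v s ≤ V) (hV : 0 < V) (hu0 : 0 ≤ u)
    (hu : 2 * V * Y ≤ u ^ 2) :
    P.real {ω | u ≤ ∑ s ∈ Finset.range n, ∑ i, a s ω i * (X ω).w s i} ≤ Real.exp (-Y) :=
  measureReal_gaussian_sum_ge_le (var := noiseVar d p.σ p.C) n
    (W := fun s ω => (X ω).w s) (fun s hs => hrun.privacy_meas s (hs.trans_le hn))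
    (fun s hs => hrun.privacy_law s (hs.trans_le hn))
    (fun s hs => indep_of_indep_of_le_right (hrun.privacy_indep s (hs.trans_le hn)) le_sup_left)
    a ha v hav hv hV hu0 hu

theorem IsRun.measureReal_abs_noise_gt_le [IsProbabilityMeasure P]
    (hrun : IsRun p θs P H D X η) {n : ℕ} (hn : n ≤ p.T) (a : ℕ → NoiseIdx d → ℝ)
    (v : ℕ → ℝ) (hav : ∀ s < n, ∑ i, a s i ^ 2 * (noiseVar d p.σ p.C i : ℝ) ≤ v s)
    {V u Y : ℝ} (hv : ∑ s ∈ Finset.range n, v s ≤ V) (hV : 0 < V) (hu0 : 0 ≤ u)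
    (hu : 2 * V * Y ≤ u ^ 2) :
    P.real {ω | u < |∑ s ∈ Finset.range n, ∑ i, a s i * (X ω).w s i|} ≤ 2 * Real.exp (-Y) := by
  have h1 := hrun.measureReal_noise_ge_le hn (fun s _ => a s) (fun _ _ => measurable_const) v
    (fun s hs _ => hav s hs) hv hV hu0 hu
  have h2 := hrun.measureReal_noise_ge_le hn (fun s _ i => -a s i) (fun _ _ => measurable_const) v
    (fun s hs _ => by simpa using hav s hs) hv hV hu0 hu
  have hsub : {ω | u < |∑ s ∈ Finset.range n, ∑ i, a s i * (X ω).w s i|} ⊆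
      {ω | u ≤ ∑ s ∈ Finset.range n, ∑ i, a s i * (X ω).w s i} ∪
      {ω | u ≤ ∑ s ∈ Finset.range n, ∑ i, -a s i * (X ω).w s i} := by
    intro ω hω
    rw [Set.mem_ofPred_eq, lt_abs] at hω
    rcases hω with h | h
    · exact Or.inl h.le
    · right
      simp only [neg_mul, Finset.sum_neg_distrib]
      exact h.le
  linarith [(measureReal_mono hsub).trans (measureReal_union_le (μ := P) _ _)]

theorem measureReal_biUnion_le_card_mul [IsProbabilityMeasure P] {β : Type*} (I : Finset β)
    (f : β → Set Ω) {b : ℝ} (hf : ∀ i ∈ I, P.real (f i) ≤ b) :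
    P.real (⋃ i ∈ I, f i) ≤ I.card * b :=
  (measureReal_biUnion_finset_le I f).trans
    ((Finset.sum_le_sum hf).trans (by rw [Finset.sum_const, nsmul_eq_mul]))

/-- Here and in the next four bounds the numbers 6, 12, 24 in `GoodNoise` are such that `u² = 2VY`
with `Y = 3L`, or `Y = 3(d + L)` for the quadratic forms. -/
theorem IsRun.measureReal_xi [IsProbabilityMeasure P] (hrun : IsRun p θs P H D X η)
    (hσ : 0 < p.σ) {L : ℝ} (hL : 0 ≤ L) {t : ℕ} (ht : t ∈ Finset.Ico 1 p.T) (i : Fin d) :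
    P.real {ω | p.σ * √(6 * t * L) < |∑ s ∈ Finset.range t, noiseXi ((X ω).w s) i|} ≤
      2 * Real.exp (-(3 * L)) := by
  have ht' := Finset.mem_Ico.1 ht
  have ht0 : (0 : ℝ) < t := by exact_mod_cast ht'.1
  have := hrun.measureReal_abs_noise_gt_le (n := t) (by omega)
    (fun _ => Pi.single (Sum.inr (Sum.inl i)) 1) (fun _ => p.σ ^ 2)
    (fun s _ => by
      rw [Fintype.sum_eq_single (Sum.inr (Sum.inl i)) fun j hj => by simp [Pi.single_eq_of_ne hj]]
      simp [noiseVar, sq_nonneg])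
    (V := t * p.σ ^ 2) (u := p.σ * √(6 * t * L)) (Y := 3 * L) (by simp) (by positivity)
    (by positivity)
    (by
      rw [mul_pow, Real.sq_sqrt (by positivity)]
      exact le_of_eq (by ring))
  have heq : ∀ w : NoiseIdx d → ℝ,
      ∑ j, (Pi.single (Sum.inr (Sum.inl i)) 1 : NoiseIdx d → ℝ) j * w j = noiseXi w i := fun w => by
    rw [Fintype.sum_eq_single (Sum.inr (Sum.inl i)) fun j hj => by simp [Pi.single_eq_of_ne hj]]
    simp [noiseXi]
  simpa only [heq] using this

theorem IsRun.measureReal_r [IsProbabilityMeasure P] (hrun : IsRun p θs P H D X η)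
    (hσ : 0 < p.σ) (hC : 0 < p.C) {L : ℝ} (hL : 0 ≤ L) {t : ℕ} (ht : t ∈ Finset.range p.T)
    (i : Fin d) :
    P.real {ω | p.C * p.σ * √(6 * L) < |noiseR ((X ω).w t) i|} ≤ 2 * Real.exp (-(3 * L)) := by
  have := hrun.measureReal_abs_noise_gt_le (n := p.T) le_rfl
    -- A single coordinate of a single round is a sum over all rounds with all other coefficients
    -- zero.
    (fun s => if s = t then Pi.single (Sum.inr (Sum.inr i)) 1 else 0)
    (fun s => if s = t then p.C ^ 2 * p.σ ^ 2 else 0)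
    (fun s _ => by
      split_ifs with h
      · rw [Fintype.sum_eq_single (Sum.inr (Sum.inr i)) fun j hj => by
          simp [Pi.single_eq_of_ne hj]]
        simp [noiseVar, mul_nonneg, sq_nonneg]
      · simp)
    (V := p.C ^ 2 * p.σ ^ 2) (u := p.C * p.σ * √(6 * L)) (Y := 3 * L)
    (by rw [Finset.sum_ite_eq', if_pos ht]) (by positivity) (by positivity)
    (by
      rw [mul_pow, Real.sq_sqrt (by positivity)]
      exact le_of_eq (by ring))
  have heq : ∀ ω, ∑ s ∈ Finset.range p.T, ∑ j,
      (if s = t then Pi.single (Sum.inr (Sum.inr i)) 1 else 0 : NoiseIdx d → ℝ) j * (X ω).w s j =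
        noiseR ((X ω).w t) i := fun ω => by
    rw [Finset.sum_eq_single_of_mem t ht fun s _ hs => by simp [hs], if_pos rfl,
      Fintype.sum_eq_single (Sum.inr (Sum.inr i)) fun j hj => by simp [Pi.single_eq_of_ne hj]]
    simp [noiseR]
  simpa only [heq] using this

theorem IsRun.measureReal_quad [IsProbabilityMeasure P] (hrun : IsRun p θs P H D X η)
    (hσ : 0 < p.σ) {L : ℝ} (hL : 0 ≤ L) {t : ℕ} (ht : t ∈ Finset.Ico 1 p.T) {c : Vec d}
    (hc : ‖c‖ ≤ 1) :
    P.real {ω | p.σ * √(12 * t * (d + L)) <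
        |∑ s ∈ Finset.range t, c.ofLp ⬝ᵥ (noiseB ((X ω).w s) *ᵥ c.ofLp)|} ≤
      2 * Real.exp (-(3 * (d + L))) := by
  have ht' := Finset.mem_Ico.1 ht
  have ht0 : (0 : ℝ) < t := by exact_mod_cast ht'.1
  have := hrun.measureReal_abs_noise_gt_le (n := t) (by omega)
    (fun _ => Sum.elim (quadCoeff c) 0) (fun _ => 2 * p.σ ^ 2)
    (fun s _ => by
      rw [Fintype.sum_sum_type]
      simp only [Sum.elim_inl, Sum.elim_inr, noiseVar, Real.coe_toNNReal _ (sq_nonneg p.σ),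
        Pi.zero_apply, ne_eq, OfNat.ofNat_ne_zero, not_false_eq_true, zero_pow, zero_mul,
        Finset.sum_const_zero, add_zero, ← Finset.sum_mul]
      exact mul_le_mul_of_nonneg_right (sum_quadCoeff_sq_le hc) (sq_nonneg _))
    (V := t * (2 * p.σ ^ 2)) (u := p.σ * √(12 * t * (d + L))) (Y := 3 * (d + L)) (by simp)
    (by positivity) (by positivity)
    (by
      rw [mul_pow, Real.sq_sqrt (by positivity)]
      exact le_of_eq (by ring))
  have heq : ∀ w : NoiseIdx d → ℝ,
      ∑ j, (Sum.elim (quadCoeff c) 0 : NoiseIdx d → ℝ) j * w j =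
        c.ofLp ⬝ᵥ (noiseB w *ᵥ c.ofLp) := fun w => by
    rw [Fintype.sum_sum_type, dotProduct_noiseB_mulVec]
    simp
  simpa only [heq] using this

/-- The coefficient `-(θ̂_s - θ*)` is known before `r_s` is drawn and has norm at most 2, so each
term has variance proxy `4C²σ²`, without a factor `d`. -/
theorem IsRun.measureReal_drift [IsProbabilityMeasure P] (hrun : IsRun p θs P H D X η)
    {G C μ : ℝ} (hg : IsLink p.g G C μ) (hW : IsClosed p.W) (hWc : Convex ℝ p.W)
    (hW1 : ∀ θ ∈ p.W, ‖θ‖ ≤ 1) (hθ : θs ∈ p.W) (hT : 0 < p.T)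
    (hσ : 0 < p.σ) (hC : 0 < p.C) {L : ℝ} (hL : 0 ≤ L) :
    P.real {ω | p.C * p.σ * √(24 * p.T * L) ≤
        -∑ s ∈ Finset.range p.T, inner ℝ (noiseR ((X ω).w s)) (thetaHat p (X ω) s - θs)} ≤
      Real.exp (-(3 * L)) := by
  have hT0 : (0 : ℝ) < p.T := by exact_mod_cast hT
  have := hrun.measureReal_noise_ge_le (n := p.T) le_rfl
    (fun s ω => Sum.elim 0 (Sum.elim 0 fun i => -(thetaHat p (X ω) s - θs) i))
    (fun s hs => by
      have hm := (measurable_id.sub_const θs).comp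
        (hrun.measurable_thetaHat hg hW hWc hW1 hθ s hs.le)
      refine @measurable_pi_lambda _ _ _ (H s) _ _ ?_
      rintro (i | i | i)
      · exact @measurable_const _ _ _ (H s) _
      · exact @measurable_const _ _ _ (H s) _
      · exact measurable_neg.comp (((EuclideanSpace.proj (𝕜 := ℝ) i).continuous.measurable).comp hm))
    (fun _ => 4 * (p.C ^ 2 * p.σ ^ 2))
    (fun s _ ω => by
      have hn := norm_thetaHat_sub_le (h := X ω) hW hW1 hθ s
      have hn2 : ‖thetaHat p (X ω) s - θs‖ ^ 2 ≤ 4 := by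
        nlinarith [norm_nonneg (thetaHat p (X ω) s - θs)]
      rw [EuclideanSpace.real_norm_sq_eq] at hn2
      have hvar : 0 ≤ p.C ^ 2 * p.σ ^ 2 := by positivity
      rw [Fintype.sum_sum_type, Fintype.sum_sum_type]
      simp only [Sum.elim_inl, Sum.elim_inr, noiseVar, Real.coe_toNNReal _ hvar,
        Pi.zero_apply, ne_eq, OfNat.ofNat_ne_zero, not_false_eq_true, zero_pow, zero_mul,
        Finset.sum_const_zero, zero_add, ← Finset.sum_mul, neg_sq]
      exact mul_le_mul_of_nonneg_right hn2 hvar)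
    (V := p.T * (4 * (p.C ^ 2 * p.σ ^ 2))) (u := p.C * p.σ * √(24 * p.T * L)) (Y := 3 * L)
    (by simp) (by positivity) (by positivity)
    (by
      rw [mul_pow, Real.sq_sqrt (by positivity)]
      exact le_of_eq (by ring))
  have heq : ∀ ω, ∑ s ∈ Finset.range p.T, ∑ j, (Sum.elim 0 (Sum.elim 0 fun i =>
      -(thetaHat p (X ω) s - θs) i) : NoiseIdx d → ℝ) j * (X ω).w s j =
      -∑ s ∈ Finset.range p.T, inner ℝ (noiseR ((X ω).w s)) (thetaHat p (X ω) s - θs) := by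
    intro ω
    rw [← Finset.sum_neg_distrib]
    refine Finset.sum_congr rfl fun s _ => ?_
    rw [Fintype.sum_sum_type, Fintype.sum_sum_type, inner_eq_dotProduct]
    simp only [Sum.elim_inl, Sum.elim_inr, Pi.zero_apply, zero_mul, Finset.sum_const_zero,
      zero_add, dotProduct, noiseR, ← Finset.sum_neg_distrib]
    exact Finset.sum_congr rfl fun i _ => by ring
  simpa only [heq] using this

theorem IsRun.measureReal_mart [IsProbabilityMeasure P] (hrun : IsRun p θs P H D X η)
    {G C μ : ℝ} (hg : IsLink p.g G C μ) (hW : IsClosed p.W) (hWc : Convex ℝ p.W)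
    (hW1 : ∀ θ ∈ p.W, ‖θ‖ ≤ 1) (hθ : θs ∈ p.W) (hT : 0 < p.T) {L : ℝ} (hL : 0 ≤ L) :
    P.real {ω | √(24 * p.T * L) ≤
        ∑ s ∈ Finset.range p.T, η s ω * labelError p θs (X ω) s} ≤ Real.exp (-(3 * L)) := by
  have hT0 : (0 : ℝ) < p.T := by exact_mod_cast hT
  refine measureReal_martingale_sum_ge_le p.T (fun s hs => hrun.noise_meas s hs)
    (fun s hs => hrun.noise_abs_le s hs) (fun s hs => hrun.noise_mean s hs)
    (fun s ω => labelError p θs (X ω) s) (fun s hs => ?_) (b := 2)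
    (fun s hs ω => abs_labelError_le hW hW1 hθ (hrun.norm_x_le hs ω))
    (V := p.T * 4) (by norm_num) (by positivity) (Real.sqrt_nonneg _) ?_
  · have hx := hrun.action_meas s hs
    exact (hx.inner (hrun.measurable_thetaHat hg hW hWc hW1 hθ s hs.le)).sub
      (hx.inner measurable_const)
  · rw [Real.sq_sqrt (by positivity)]
    exact le_of_eq (by ring)

theorem IsRun.exists_goodNoise [IsProbabilityMeasure P] (hrun : IsRun p θs P H D X η)
    {G C μ : ℝ} (hg : IsLink p.g G C μ) (hW : IsClosed p.W) (hWc : Convex ℝ p.W)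
    (hW1 : ∀ θ ∈ p.W, ‖θ‖ ≤ 1) (hθ : θs ∈ p.W) (hd : 1 ≤ d) (hdT : d < p.T)
    (hσ : 0 < p.σ) (hC : 0 < p.C) (hα : 0 < p.α) (hα1 : p.α ≤ 1)
    {N : Finset (Vec d)} (hN1 : ∀ c ∈ N, ‖c‖ ≤ 1) (hN : N.card ≤ 9 ^ d) :
    ∃ E : Set Ω, MeasurableSet E ∧ 1 - p.α ≤ P.real E ∧ ∀ ω ∈ E,
      GoodNoise p θs N (Real.log (2 * p.T / p.α)) (X ω) (fun t => η t ω) := by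
  have hT : 0 < p.T := by omega
  have hT1 : (1 : ℝ) ≤ p.T := by exact_mod_cast hT
  have hdT' : (d : ℝ) + 1 ≤ p.T := by exact_mod_cast hdT
  have hd' : (1 : ℝ) ≤ d := by exact_mod_cast hd
  set L := Real.log (2 * p.T / p.α) with hLdef
  have hL : 0 ≤ L := Real.log_nonneg (by rw [le_div_iff₀ hα]; linarith)
  set e := Real.exp (-(3 * L)) with he
  have he_eq : e = (p.α / (2 * p.T)) ^ 3 := by
    have h1 : e = Real.exp (-L) ^ 3 := by
      rw [he, ← Real.exp_nat_mul]
      congr 1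
      push_cast
      ring
    rw [h1, Real.exp_neg, hLdef, Real.exp_log (by positivity), inv_div]
  have he0 : 0 < e := Real.exp_pos _
  set S1 : Set Ω := ⋃ z ∈ Finset.Ico 1 p.T ×ˢ (Finset.univ : Finset (Fin d)),
    {ω | p.σ * √(6 * z.1 * L) < |∑ s ∈ Finset.range z.1, noiseXi ((X ω).w s) z.2|} with hS1
  set S2 : Set Ω := ⋃ z ∈ Finset.range p.T ×ˢ (Finset.univ : Finset (Fin d)),
    {ω | p.C * p.σ * √(6 * L) < |noiseR ((X ω).w z.1) z.2|} with hS2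
  set S3 : Set Ω := ⋃ z ∈ Finset.Ico 1 p.T ×ˢ N,
    {ω | p.σ * √(12 * z.1 * (d + L)) <
      |∑ s ∈ Finset.range z.1, z.2.ofLp ⬝ᵥ (noiseB ((X ω).w s) *ᵥ z.2.ofLp)|} with hS3
  set S4 : Set Ω := {ω | p.C * p.σ * √(24 * p.T * L) ≤
    -∑ s ∈ Finset.range p.T, inner ℝ (noiseR ((X ω).w s)) (thetaHat p (X ω) s - θs)} with hS4
  set S5 : Set Ω := {ω | √(24 * p.T * L) ≤
    ∑ s ∈ Finset.range p.T, η s ω * labelError p θs (X ω) s} with hS5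
  have h1 : P.real S1 ≤ (p.T * d) * (2 * e) := by
    refine (measureReal_biUnion_le_card_mul _ _ fun z hz =>
      hrun.measureReal_xi hσ hL (Finset.mem_product.1 hz).1 z.2).trans ?_
    refine mul_le_mul_of_nonneg_right ?_ (by positivity)
    rw [Finset.card_product, Nat.card_Ico, Finset.card_univ, Fintype.card_fin]
    exact_mod_cast Nat.mul_le_mul_right d (Nat.sub_le _ _)
  have h2 : P.real S2 ≤ (p.T * d) * (2 * e) := by
    refine (measureReal_biUnion_le_card_mul _ _ fun z hz =>
      hrun.measureReal_r hσ hC hL (Finset.mem_product.1 hz).1 z.2).trans (le_of_eq ?_)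
    rw [Finset.card_product, Finset.card_range, Finset.card_univ, Fintype.card_fin, Nat.cast_mul]
  have h3 : P.real S3 ≤ p.T * (2 * e) := by
    refine (measureReal_biUnion_le_card_mul _ _ fun z hz =>
      hrun.measureReal_quad hσ hL (Finset.mem_product.1 hz).1
        (hN1 _ (Finset.mem_product.1 hz).2)).trans ?_
    rw [Finset.card_product, Nat.card_Ico, Nat.cast_mul]
    -- The extra `d` in the exponent pays for the union over the net, since `9 ≤ e³`.
    have hsplit : Real.exp (-(3 * (d + L))) = Real.exp (-3) ^ d * e := by
      rw [he, ← Real.exp_nat_mul, ← Real.exp_add]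
      congr 1
      ring
    have hcard : (N.card : ℝ) * Real.exp (-3) ^ d ≤ 1 := by
      have h9 : (N.card : ℝ) ≤ 9 ^ d := by exact_mod_cast hN
      calc _ ≤ (9 : ℝ) ^ d * Real.exp (-3) ^ d := by gcongr
        _ = (9 * Real.exp (-3)) ^ d := (mul_pow _ _ _).symm
        _ ≤ 1 := by
            refine pow_le_one₀ (by positivity) ?_
            have h3 : (9 : ℝ) ≤ Real.exp 3 := by
              have h27 := Real.exp_one_gt_d9
              have : Real.exp 3 = Real.exp 1 ^ 3 := by rw [← Real.exp_nat_mul]; norm_num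
              rw [this]
              have : (2.7 : ℝ) ^ 3 ≤ Real.exp 1 ^ 3 := pow_le_pow_left₀ (by norm_num)
                (by linarith) 3
              norm_num at this
              linarith
            rw [Real.exp_neg, ← div_eq_mul_inv, div_le_one (Real.exp_pos _)]
            exact h3
    have hTm : ((p.T - 1 : ℕ) : ℝ) ≤ p.T := by exact_mod_cast Nat.sub_le _ _
    calc _ = ((p.T - 1 : ℕ) : ℝ) * (2 * (N.card * Real.exp (-3) ^ d * e)) := by
          rw [hsplit]
          ring
      _ ≤ p.T * (2 * (1 * e)) := by gcongr
      _ = _ := by rw [one_mul]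
  have h4 : P.real S4 ≤ e := hrun.measureReal_drift hg hW hWc hW1 hθ hT hσ hC hL
  have h5 : P.real S5 ≤ e := hrun.measureReal_mart hg hW hWc hW1 hθ hT hL
  set S := S1 ∪ S2 ∪ S3 ∪ S4 ∪ S5 with hS
  have hbad : P.real S ≤ p.α := by
    have hu : P.real S ≤ P.real S1 + P.real S2 + P.real S3 + P.real S4 + P.real S5 := by
      have u1 := measureReal_union_le (μ := P) (S1 ∪ S2 ∪ S3 ∪ S4) S5
      have u2 := measureReal_union_le (μ := P) (S1 ∪ S2 ∪ S3) S4
      have u3 := measureReal_union_le (μ := P) (S1 ∪ S2) S3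
      have u4 := measureReal_union_le (μ := P) S1 S2
      linarith
    -- Uses `d + 1 ≤ T`. As `e = (α / 2T)³`, the total is then at most `α · α² / (2T) ≤ α`.
    have hcount : (p.T * d) * (2 * e) + (p.T * d) * (2 * e) + p.T * (2 * e) + e + e ≤
        4 * (p.T : ℝ) ^ 2 * e := by
      have : 4 * ((p.T : ℝ) * d) + 2 * p.T + 2 ≤ 4 * (p.T : ℝ) ^ 2 := by nlinarith
      nlinarith
    have hfin : 4 * (p.T : ℝ) ^ 2 * e ≤ p.α := by
      rw [he_eq]
      have h6 : 4 * (p.T : ℝ) ^ 2 * (p.α / (2 * p.T)) ^ 3 = p.α * (p.α ^ 2 / (2 * p.T)) := by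
        field_simp
        ring
      rw [h6]
      refine mul_le_of_le_one_right hα.le ?_
      rw [div_le_one (by positivity)]
      nlinarith
    linarith
  -- The complement of a measurable hull spares a proof that the bad set is measurable.
  refine ⟨(toMeasurable P S)ᶜ, (measurableSet_toMeasurable P S).compl, ?_, fun ω hω => ?_⟩
  · rw [probReal_compl_eq_one_sub (measurableSet_toMeasurable P S), measureReal_def,
      measure_toMeasurable, ← measureReal_def]
    linarith
  · have hωS : ω ∉ S := fun hmem => hω (subset_toMeasurable P S hmem)
    simp only [hS, Set.mem_union, not_or] at hωS
    obtain ⟨⟨⟨⟨n1, n2⟩, n3⟩, n4⟩, n5⟩ := hωS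
    refine ⟨fun t ht i => ?_, fun t ht i => ?_, fun t ht c hc => ?_, ?_, ?_⟩
    · by_contra! hlt
      exact n1 (Set.mem_iUnion₂.2 ⟨(t, i), Finset.mem_product.2 ⟨ht, Finset.mem_univ _⟩, hlt⟩)
    · by_contra! hlt
      exact n2 (Set.mem_iUnion₂.2 ⟨(t, i), Finset.mem_product.2 ⟨ht, Finset.mem_univ _⟩, hlt⟩)
    · by_contra! hlt
      exact n3 (Set.mem_iUnion₂.2 ⟨(t, c), Finset.mem_product.2 ⟨ht, hc⟩, hlt⟩)
    · exact (not_le.1 n4).le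
    · exact (not_le.1 n5).le

end Run

/-! ### The confidence ellipsoids -/

section Confidence

variable {d : ℕ} {p : Params d} {θs : Vec d} {h : Transcript d} {η : ℕ → ℝ} {N : Finset (Vec d)}
  {L : ℝ}

/-- The scale `σ √(dT) L` of the squared confidence widths. -/
noncomputable def widthScale (p : Params d) (L : ℝ) : ℝ := p.σ * √((d : ℝ) * p.T) * L

theorem isSymm_noiseB (w : NoiseIdx d → ℝ) : (noiseB w).IsSymm := by
  ext i j
  simp only [noiseB, Matrix.transpose_apply, Matrix.of_apply, min_comm j i, max_comm j i]

theorem isSymm_sum_noiseB (t : ℕ) : (∑ s ∈ Finset.range t, noiseB (h.w s)).IsSymm := by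
  rw [Matrix.IsSymm, Matrix.transpose_sum]
  exact Finset.sum_congr rfl fun s _ => isSymm_noiseB _

theorem Vtilde_eq (p : Params d) (h : Transcript d) (t : ℕ) :
    Vtilde p h t = ∑ s ∈ Finset.range t, Matrix.vecMulVec (h.x s).ofLp (h.x s).ofLp +
      ∑ s ∈ Finset.range t, noiseB (h.w s) +
      (2 * p.upsilon t) • (1 : Matrix (Fin d) (Fin d) ℝ) := by
  rw [Vtilde, Finset.sum_add_distrib]

theorem isHermitian_Vtilde (p : Params d) (h : Transcript d) (t : ℕ) :
    (Vtilde p h t).IsHermitian := by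
  have hB := isSymm_sum_noiseB (h := h) t
  have hx : (∑ s ∈ Finset.range t, Matrix.vecMulVec (h.x s).ofLp (h.x s).ofLp).IsSymm := by
    rw [Matrix.IsSymm, Matrix.transpose_sum]
    exact Finset.sum_congr rfl fun s _ => Matrix.transpose_vecMulVec _ _
  rw [Matrix.IsHermitian, Matrix.conjTranspose_eq_transpose_of_trivial, Vtilde_eq,
    Matrix.transpose_add, Matrix.transpose_add, hB, hx, Matrix.transpose_smul,
    Matrix.transpose_one]

theorem GoodNoise.abs_sum_noiseB_le (hgood : GoodNoise p θs N L h η) (hN1 : ∀ c ∈ N, ‖c‖ ≤ 1)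
    (hnet : ∀ x : Vec d, ‖x‖ ≤ 1 → ∃ c ∈ N, ‖x - c‖ ≤ 1 / 4) (hσ : 0 < p.σ)
    (hL : L = Real.log (2 * p.T / p.α)) (hL0 : 0 ≤ L) (hd1 : 1 ≤ d) {t : ℕ} (ht : t ∈ Finset.Ico 1 p.T)
    (x y : Vec d) :
    |x.ofLp ⬝ᵥ ((∑ s ∈ Finset.range t, noiseB (h.w s)) *ᵥ y.ofLp)| ≤
      7 / 8 * (2 * p.upsilon t) * ‖x‖ * ‖y‖ := by
  refine (abs_dotProduct_mulVec_le_of_net hN1 hnet (isSymm_sum_noiseB t)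
    (M := p.σ * √(12 * t * (d + L))) (fun c hc => ?_) x y).trans ?_
  · rw [Matrix.sum_mulVec, dotProduct_sum]
    exact hgood.quad t ht c hc
  -- The fraction `7/8` works because `(7/8)² · 16 = 12.25 ≥ 12`, for the `d` term and, as `√d ≥ 1`,
  -- for the cross term `√d L`.
  · have hsq : √(12 * t * (d + L)) ≤ √(t : ℝ) * (7 / 8 * (4 * √(d : ℝ) + 2 * L)) := by
      rw [Real.sqrt_le_left (by positivity), mul_pow, Real.sq_sqrt (Nat.cast_nonneg t)]
      have hd := Real.sq_sqrt (Nat.cast_nonneg (α := ℝ) d)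
      have hd1 : 1 ≤ √(d : ℝ) := Real.one_le_sqrt.2 (by exact_mod_cast hd1)
      rw [mul_comm (12 : ℝ), mul_assoc]
      refine mul_le_mul_of_nonneg_left ?_ (Nat.cast_nonneg t)
      nlinarith [mul_nonneg hL0 (sub_nonneg.2 hd1), mul_nonneg hL0 hL0]
    have : 2 * (p.σ * √(12 * t * (d + L))) ≤ 7 / 8 * (2 * p.upsilon t) := by
      rw [Params.upsilon, ← hL]
      calc _ ≤ 2 * (p.σ * (√(t : ℝ) * (7 / 8 * (4 * √(d : ℝ) + 2 * L)))) := by gcongr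
        _ = _ := by ring
    gcongr

/-- The accumulated matrix noise uses at most `7/8` of the shift `2Υ_t`; the remaining eighth is the
curvature `Υ_t / 4`. -/
theorem GoodNoise.le_dotProduct_Vtilde_mulVec (hgood : GoodNoise p θs N L h η)
    (hN1 : ∀ c ∈ N, ‖c‖ ≤ 1) (hnet : ∀ x : Vec d, ‖x‖ ≤ 1 → ∃ c ∈ N, ‖x - c‖ ≤ 1 / 4)
    (hσ : 0 < p.σ) (hL : L = Real.log (2 * p.T / p.α)) (hL0 : 0 ≤ L) (hd1 : 1 ≤ d) {t : ℕ}
    (ht : t ∈ Finset.Ico 1 p.T) (y : Vec d) :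
    ∑ s ∈ Finset.range t, (inner ℝ (h.x s) y) ^ 2 + p.upsilon t / 4 * ‖y‖ ^ 2 ≤
      y.ofLp ⬝ᵥ (Vtilde p h t *ᵥ y.ofLp) := by
  have hB := (abs_le.1 (hgood.abs_sum_noiseB_le hN1 hnet hσ hL hL0 hd1 ht y y)).1
  rw [Vtilde_eq, Matrix.add_mulVec, Matrix.add_mulVec, dotProduct_add, dotProduct_add,
    Matrix.sum_mulVec, dotProduct_sum, Matrix.smul_mulVec, Matrix.one_mulVec, dotProduct_smul,
    ← inner_eq_dotProduct y y, real_inner_self_eq_norm_sq, smul_eq_mul]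
  simp only [dotProduct_vecMulVec_mulVec]
  nlinarith

theorem upsilon_pos (hσ : 0 < p.σ) (hL : L = Real.log (2 * p.T / p.α)) (hL0 : 0 ≤ L)
    (hd1 : 1 ≤ d) {t : ℕ} (ht : 1 ≤ t) : 4 * p.σ * √(t : ℝ) * √(d : ℝ) ≤ p.upsilon t ∧
      0 < p.upsilon t := by
  have ht' : 0 < √(t : ℝ) := Real.sqrt_pos.2 (by exact_mod_cast ht)
  have hd' : 0 < √(d : ℝ) := Real.sqrt_pos.2 (by exact_mod_cast hd1)
  rw [Params.upsilon, ← hL]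
  constructor
  · have : 0 ≤ p.σ * √(t : ℝ) * (2 * L) := by positivity
    nlinarith
  · positivity

theorem GoodNoise.posDef_Vtilde (hgood : GoodNoise p θs N L h η)
    (hN1 : ∀ c ∈ N, ‖c‖ ≤ 1) (hnet : ∀ x : Vec d, ‖x‖ ≤ 1 → ∃ c ∈ N, ‖x - c‖ ≤ 1 / 4)
    (hσ : 0 < p.σ) (hL : L = Real.log (2 * p.T / p.α)) (hL0 : 0 ≤ L) (hd1 : 1 ≤ d) {t : ℕ}
    (ht : t ∈ Finset.Ico 1 p.T) : (Vtilde p h t).PosDef := by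
  refine Matrix.PosDef.of_dotProduct_mulVec_pos (isHermitian_Vtilde _ _ _) fun y hy => ?_
  have h1 := hgood.le_dotProduct_Vtilde_mulVec hN1 hnet hσ hL hL0 hd1 ht (WithLp.toLp 2 y)
  refine lt_of_lt_of_le ?_ h1
  have hy' : 0 < ‖(WithLp.toLp 2 y : Vec d)‖ := norm_pos_iff.2 (by simpa using hy)
  have h2 : 0 ≤ ∑ s ∈ Finset.range t, (inner ℝ (h.x s) (WithLp.toLp 2 y : Vec d)) ^ 2 :=
    Finset.sum_nonneg fun _ _ => sq_nonneg _
  have h3 := (upsilon_pos hσ hL hL0 hd1 (Finset.mem_Ico.1 ht).1).2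
  positivity

/-- The part of `Ṽ_t (θ̃_t - θ*)` that is caused by the injected noise and the regularization. -/
noncomputable def noiseError (p : Params d) (θs : Vec d) (h : Transcript d) (t : ℕ) : Vec d :=
  ∑ s ∈ Finset.range t, noiseXi (h.w s) -
    WithLp.toLp 2 ((∑ s ∈ Finset.range t, noiseB (h.w s)) *ᵥ θs.ofLp) - (2 * p.upsilon t) • θs

/-- The error equation: `Ṽ_t θ̃_t = ũ_t`, and `Ṽ_t θ*` contains `∑ ⟨x_s, θ*⟩ x_s`, so only label
errors multiply the actions. -/
theorem Vtilde_mulVec_sub {t : ℕ} (hA : (Vtilde p h t).PosDef) :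
    Vtilde p h t *ᵥ (thetaTilde p h t - θs).ofLp =
      (∑ s ∈ Finset.range t, labelError p θs h s • h.x s + noiseError p θs h t).ofLp := by
  have h1 : ∀ s, (Matrix.vecMulVec (h.x s).ofLp (h.x s).ofLp) *ᵥ θs.ofLp =
      ((inner ℝ (h.x s) θs : ℝ) • h.x s).ofLp := fun s => by
    rw [Matrix.vecMulVec_mulVec, inner_eq_dotProduct, WithLp.ofLp_smul, op_smul_eq_smul]
  rw [WithLp.ofLp_sub, Matrix.mulVec_sub, thetaTilde, mulVec_inv_mulVec hA, Vtilde_eq,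
    Matrix.add_mulVec, Matrix.add_mulVec, Matrix.sum_mulVec, Matrix.smul_mulVec,
    Matrix.one_mulVec]
  simp only [h1, utilde, labelError, noiseError, sub_smul, Finset.sum_add_distrib,
    Finset.sum_sub_distrib, WithLp.ofLp_add, WithLp.ofLp_sub, WithLp.ofLp_sum, WithLp.ofLp_smul]
  abel

/-- With `Q = widthScale p L` and `U = Υ_t`, the numerator is at most `3‖∑ξ‖² + 24U²`, where `‖∑ξ‖²
≤ (3/2) U Q` and `U ≤ 6Q`. Hence `594 = 4 · (4.5 + 144)`. -/
theorem norm_noiseError_sq_div_le (hgood : GoodNoise p θs N L h η)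
    (hN1 : ∀ c ∈ N, ‖c‖ ≤ 1) (hnet : ∀ x : Vec d, ‖x‖ ≤ 1 → ∃ c ∈ N, ‖x - c‖ ≤ 1 / 4)
    (hσ : 0 < p.σ) (hL : L = Real.log (2 * p.T / p.α)) (hL1 : 1 ≤ L) (hd1 : 1 ≤ d) {t : ℕ}
    (ht : t ∈ Finset.Ico 1 p.T) (hθ : ‖θs‖ ≤ 1) :
    ‖noiseError p θs h t‖ ^ 2 / (p.upsilon t / 4) ≤ 594 * widthScale p L := by
  have hL0 : 0 ≤ L := by linarith
  obtain ⟨ht1, htT⟩ := Finset.mem_Ico.1 ht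
  obtain ⟨hU1, hU0⟩ := upsilon_pos hσ hL hL0 hd1 ht1
  set U := p.upsilon t with hU
  set xi := ∑ s ∈ Finset.range t, noiseXi (h.w s) with hxi
  set b : Vec d := WithLp.toLp 2 ((∑ s ∈ Finset.range t, noiseB (h.w s)) *ᵥ θs.ofLp) with hb
  have hxin : ‖xi‖ ^ 2 ≤ d * (p.σ ^ 2 * (6 * t * L)) := by
    rw [EuclideanSpace.real_norm_sq_eq]
    calc ∑ i, xi i ^ 2 ≤ ∑ _i : Fin d, p.σ ^ 2 * (6 * t * L) := by
          refine Finset.sum_le_sum fun i _ => ?_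
          have h1 := hgood.xi t ht i
          have h2 : xi i = ∑ s ∈ Finset.range t, noiseXi (h.w s) i := by
            rw [hxi, WithLp.ofLp_sum, Finset.sum_apply]
          rw [h2, ← sq_abs]
          refine (pow_le_pow_left₀ (abs_nonneg _) h1 2).trans (le_of_eq ?_)
          rw [mul_pow, Real.sq_sqrt (by positivity)]
      _ = _ := by simp
  -- Test the bilinear bound with `b = (∑ B_s) θ*` itself and cancel one factor `‖b‖`.
  have hbn : ‖b‖ ≤ 2 * U := by
    have h1 := hgood.abs_sum_noiseB_le hN1 hnet hσ hL hL0 hd1 ht b θs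
    have h2 : b.ofLp ⬝ᵥ ((∑ s ∈ Finset.range t, noiseB (h.w s)) *ᵥ θs.ofLp) = ‖b‖ ^ 2 := by
      rw [← real_inner_self_eq_norm_sq, inner_eq_dotProduct]
    rw [h2, abs_of_nonneg (sq_nonneg _)] at h1
    have h3 : 7 / 8 * (2 * U) * ‖b‖ * ‖θs‖ ≤ 2 * U * ‖b‖ := by
      have : ‖b‖ * ‖θs‖ ≤ ‖b‖ := mul_le_of_le_one_right (norm_nonneg _) hθ
      have h4 : 0 ≤ ‖b‖ * ‖θs‖ := by positivity
      nlinarith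
    rcases (norm_nonneg b).eq_or_lt with h0 | h0
    · rw [← h0]
      positivity
    · nlinarith
  have hθn : ‖(2 * U) • θs‖ ≤ 2 * U := by
    rw [norm_smul, Real.norm_eq_abs, abs_of_pos (by positivity)]
    exact mul_le_of_le_one_right (by positivity) hθ
  have hnorm : ‖noiseError p θs h t‖ ≤ ‖xi‖ + 4 * U := by
    rw [noiseError, ← hxi, ← hb, ← hU]
    linarith [norm_sub_le (xi - b) ((2 * U) • θs), norm_sub_le xi b]
  have hsq : ‖noiseError p θs h t‖ ^ 2 ≤ 3 * ‖xi‖ ^ 2 + 24 * U ^ 2 := by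
    have := pow_le_pow_left₀ (norm_nonneg _) hnorm 2
    nlinarith [sq_nonneg (‖xi‖ - 2 * U)]
  have hroot : √(t : ℝ) * √(d : ℝ) ≤ √((d : ℝ) * p.T) := by
    rw [← Real.sqrt_mul (Nat.cast_nonneg t), mul_comm]
    have : (t : ℝ) ≤ p.T := by exact_mod_cast htT.le
    gcongr
  have hU2 : U ≤ 6 * widthScale p L := by
    have hsd : 1 ≤ √(d : ℝ) := Real.one_le_sqrt.2 (by exact_mod_cast hd1)
    have h1 : 4 * √(d : ℝ) + 2 * L ≤ 6 * (√(d : ℝ) * L) := by nlinarith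
    rw [hU, Params.upsilon, ← hL, widthScale]
    calc _ ≤ p.σ * √(t : ℝ) * (6 * (√(d : ℝ) * L)) := by gcongr
      _ = 6 * (p.σ * (√(t : ℝ) * √(d : ℝ)) * L) := by ring
      _ ≤ _ := by gcongr
  have hxiU : ‖xi‖ ^ 2 ≤ U * (3 / 2 * widthScale p L) := by
    have ht2 := Real.sq_sqrt (Nat.cast_nonneg (α := ℝ) t)
    have hd2 := Real.sq_sqrt (Nat.cast_nonneg (α := ℝ) d)
    calc ‖xi‖ ^ 2 ≤ d * (p.σ ^ 2 * (6 * t * L)) := hxin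
      _ = (4 * p.σ * √(t : ℝ) * √(d : ℝ)) * (3 / 2 * (p.σ * (√(t : ℝ) * √(d : ℝ)) * L)) := by
          nth_rewrite 1 [← ht2, ← hd2]
          ring
      _ ≤ _ := by
          rw [widthScale]
          gcongr
  rw [div_le_iff₀ (by positivity)]
  have hW : U * U ≤ U * (6 * widthScale p L) := mul_le_mul_of_nonneg_left hU2 hU0.le
  nlinarith

/-- The confidence bound for the private estimator. -/
theorem GoodNoise.abs_inner_thetaTilde_sub_le (hgood : GoodNoise p θs N L h η)
    (hN1 : ∀ c ∈ N, ‖c‖ ≤ 1) (hnet : ∀ x : Vec d, ‖x‖ ≤ 1 → ∃ c ∈ N, ‖x - c‖ ≤ 1 / 4)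
    (hσ : 0 < p.σ) (hL : L = Real.log (2 * p.T / p.α)) (hL1 : 1 ≤ L) (hd1 : 1 ≤ d) {t : ℕ}
    (ht : t ∈ Finset.Ico 1 p.T) (hθ : ‖θs‖ ≤ 1) {b : ℝ} (hb0 : 0 ≤ b)
    (hb : ∑ s ∈ Finset.range p.T, labelError p θs h s ^ 2 + 594 * widthScale p L ≤ b ^ 2)
    (v : Vec d) :
    |inner ℝ (thetaTilde p h t - θs) v| ≤ b * matNorm (Vtilde p h t)⁻¹ v := by
  have hL0 : 0 ≤ L := by linarith
  have hU0 := (upsilon_pos hσ hL hL0 hd1 (Finset.mem_Ico.1 ht).1).2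
  have hA := hgood.posDef_Vtilde hN1 hnet hσ hL hL0 hd1 ht
  refine (abs_inner_inv_mulVec_le hA (Finset.range t) h.x (labelError p θs h)
    (noiseError p θs h t) (lam := p.upsilon t / 4) (by positivity)
    (hgood.le_dotProduct_Vtilde_mulVec hN1 hnet hσ hL hL0 hd1 ht) _ v
    (Vtilde_mulVec_sub hA)).trans ?_
  refine mul_le_mul_of_nonneg_right ?_ (Real.sqrt_nonneg _)
  rw [Real.sqrt_le_left hb0]
  refine le_trans (add_le_add ?_
    (norm_noiseError_sq_div_le hgood hN1 hnet hσ hL hL1 hd1 ht hθ)) hb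
  exact Finset.sum_le_sum_of_subset_of_nonneg
    (Finset.range_subset_range.2 (Finset.mem_Ico.1 ht).2.le) fun _ _ _ => sq_nonneg _

/-- The number of mistakes of the relabelled rewards, measured by their squared errors. -/
theorem GoodNoise.sum_labelError_sq_le (hgood : GoodNoise p θs N L h η) {G μ σ₀ a₁ a₂ : ℝ}
    (hC : 0 < p.C) (hμ : 0 < μ) (hg : IsLink p.g G p.C μ)
    (hW : IsClosed p.W) (hWc : Convex ℝ p.W) (hW1 : ∀ θ ∈ p.W, ‖θ‖ ≤ 1) (hθ : θs ∈ p.W)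
    (hx : ∀ t < p.T, ‖h.x t‖ ≤ 1) (hη : ∀ t < p.T, |η t| ≤ 1)
    (hy : ∀ t < p.T, h.y t = p.g (inner ℝ (h.x t) θs) + η t)
    (hd : 1 ≤ d) (hT : 1 ≤ p.T) (hL1 : 1 ≤ L) (hσ₀ : 0 < σ₀) (hσ : σ₀ ≤ p.σ)
    (ha₁ : 0 < a₁) (ha : a₁ ≤ a₂) (hζ₁ : a₁ / (p.C * p.σ * √((d : ℝ) * p.T)) ≤ p.ζ)
    (hζ₂ : p.ζ ≤ a₂ / (p.C * p.σ * √((d : ℝ) * p.T))) :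
    ∑ t ∈ Finset.range p.T, labelError p θs h t ^ 2 ≤
      (1 / (2 * a₁) + 5 / (p.C * σ₀) + 5 + a₂ * (2 * p.C + 1) ^ 2 / (p.C ^ 2 * σ₀ ^ 2) + 6 * a₂) *
        (p.C / μ * widthScale p L) := by
  have hσp : 0 < p.σ := hσ₀.trans_le hσ
  have ha₂ : 0 < a₂ := ha₁.trans_le ha
  have hd' : (1 : ℝ) ≤ d := by exact_mod_cast hd
  have hT' : (1 : ℝ) ≤ p.T := by exact_mod_cast hT
  set R := √((d : ℝ) * p.T) with hR
  have hR1 : 1 ≤ R := Real.one_le_sqrt.2 (by nlinarith)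
  have hR0 : 0 < R := by linarith
  have hR2 : R ^ 2 = d * p.T := Real.sq_sqrt (by positivity)
  have hζ : 0 < p.ζ := lt_of_lt_of_le (by positivity) hζ₁
  have hQ : widthScale p L = p.σ * R * L := rfl
  set Q := widthScale p L
  have hQ0 : 0 < Q := by rw [hQ]; positivity
  have hmain := LDPBandit.sum_labelError_sq_le (h := h) hC.le hg hW hWc hW1 hθ hζ hx hη hy
  set S := ∑ t ∈ Finset.range p.T, labelError p θs h t ^ 2
  have hr : ∑ t ∈ Finset.range p.T, (2 * (2 * p.C + 1) ^ 2 + 2 * ‖noiseR (h.w t)‖ ^ 2) ≤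
      p.T * (2 * (2 * p.C + 1) ^ 2 + 2 * (d * (p.C ^ 2 * p.σ ^ 2 * (6 * L)))) := by
    rw [← nsmul_eq_mul, ← Finset.card_range p.T, ← Finset.sum_const, Finset.card_range]
    refine Finset.sum_le_sum fun t ht => ?_
    have : ‖noiseR (h.w t)‖ ^ 2 ≤ d * (p.C ^ 2 * p.σ ^ 2 * (6 * L)) := by
      rw [EuclideanSpace.real_norm_sq_eq]
      calc _ ≤ ∑ _i : Fin d, p.C ^ 2 * p.σ ^ 2 * (6 * L) := by
            refine Finset.sum_le_sum fun i _ => ?_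
            rw [← sq_abs]
            refine (pow_le_pow_left₀ (abs_nonneg _) (hgood.r t ht i) 2).trans (le_of_eq ?_)
            rw [mul_pow, mul_pow, Real.sq_sqrt (by positivity)]
        _ = _ := by simp
    linarith
  have hroot : √(24 * p.T * L) ≤ 5 * (R * L) := by
    rw [Real.sqrt_le_left (by positivity)]
    have h1 : (p.T : ℝ) * L ≤ R ^ 2 * L ^ 2 := by
      rw [hR2]
      have : (p.T : ℝ) ≤ d * p.T := by nlinarith
      have : L ≤ L ^ 2 := by nlinarith
      gcongr
    nlinarith
  have hmart := hgood.mart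
  have hdrift := hgood.drift
  -- Division by `2ζ`. The terms, estimated in `e1` to `e5`, give the five summands of the constant;
  -- those lacking the factor `σ` are absorbed through `σ₀ ≤ σ`, and 5 stands for `√24`.
  have hdiv : μ * S ≤ 1 / (2 * p.ζ) + 5 * (R * L) + p.C * p.σ * (5 * (R * L)) +
      p.ζ * (p.T * ((2 * p.C + 1) ^ 2 + d * (p.C ^ 2 * p.σ ^ 2 * (6 * L)))) := by
    have h1 : p.C * p.σ * √(24 * p.T * L) ≤ p.C * p.σ * (5 * (R * L)) := by gcongr
    have h2 := mul_le_mul_of_nonneg_left (hmart.trans hroot) (by positivity : 0 ≤ 2 * p.ζ)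
    have h3 := mul_le_mul_of_nonneg_left (hdrift.trans h1) (by positivity : 0 ≤ 2 * p.ζ)
    have h4 := mul_le_mul_of_nonneg_left hr (sq_nonneg p.ζ)
    have h5 : 2 * p.ζ * (μ * S) ≤ 2 * p.ζ * (1 / (2 * p.ζ) + 5 * (R * L) +
        p.C * p.σ * (5 * (R * L)) +
        p.ζ * (p.T * ((2 * p.C + 1) ^ 2 + d * (p.C ^ 2 * p.σ ^ 2 * (6 * L))))) := by
      have h6 : 2 * p.ζ * (1 / (2 * p.ζ)) = 1 := by field_simp
      rw [mul_add, mul_add, mul_add, h6]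
      linarith
    exact le_of_mul_le_mul_left h5 (by positivity)
  have e1 : 1 / (2 * p.ζ) ≤ 1 / (2 * a₁) * (p.C * Q) := by
    have h1 : 1 / p.ζ ≤ p.C * p.σ * R / a₁ := by
      rw [div_le_div_iff₀ hζ ha₁]
      rw [div_le_iff₀ (by positivity)] at hζ₁
      linarith
    have h2 : p.C * p.σ * R ≤ p.C * Q := by
      rw [hQ]
      have : p.C * p.σ * R * 1 ≤ p.C * p.σ * R * L := by gcongr
      linarith
    calc 1 / (2 * p.ζ) = 1 / 2 * (1 / p.ζ) := by field_simp
      _ ≤ 1 / 2 * (p.C * Q / a₁) := by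
          have : p.C * p.σ * R / a₁ ≤ p.C * Q / a₁ := by gcongr
          linarith
      _ = _ := by field_simp
  have e2 : 5 * (R * L) ≤ 5 / (p.C * σ₀) * (p.C * Q) := by
    have h1 : σ₀ * (R * L) ≤ Q := by
      rw [hQ, mul_assoc]
      gcongr
    calc 5 * (R * L) = 5 / (p.C * σ₀) * (p.C * (σ₀ * (R * L))) := by field_simp
      _ ≤ _ := by gcongr
  have e3 : p.C * p.σ * (5 * (R * L)) = 5 * (p.C * Q) := by
    rw [hQ]
    ring
  have e4 : p.ζ * (p.T * (2 * p.C + 1) ^ 2) ≤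
      a₂ * (2 * p.C + 1) ^ 2 / (p.C ^ 2 * σ₀ ^ 2) * (p.C * Q) := by
    have h1 : (p.T : ℝ) ≤ R ^ 2 := by rw [hR2]; nlinarith
    calc _ ≤ a₂ / (p.C * p.σ * R) * (R ^ 2 * (2 * p.C + 1) ^ 2) := by gcongr
      _ = a₂ * (2 * p.C + 1) ^ 2 / (p.C ^ 2 * p.σ ^ 2) * (p.C * (p.σ * R * 1)) := by field_simp
      _ ≤ a₂ * (2 * p.C + 1) ^ 2 / (p.C ^ 2 * σ₀ ^ 2) * (p.C * (p.σ * R * L)) := by gcongr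
      _ = _ := by rw [hQ]
  have e5 : p.ζ * (p.T * (d * (p.C ^ 2 * p.σ ^ 2 * (6 * L)))) ≤ 6 * a₂ * (p.C * Q) := by
    calc _ = p.ζ * (R ^ 2 * (p.C ^ 2 * p.σ ^ 2 * (6 * L))) := by rw [hR2]; ring
      _ ≤ a₂ / (p.C * p.σ * R) * (R ^ 2 * (p.C ^ 2 * p.σ ^ 2 * (6 * L))) := by gcongr
      _ = _ := by
        rw [hQ]
        field_simp
  have hfin : μ * S ≤ (1 / (2 * a₁) + 5 / (p.C * σ₀) + 5 +
      a₂ * (2 * p.C + 1) ^ 2 / (p.C ^ 2 * σ₀ ^ 2) + 6 * a₂) * (p.C * Q) := by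
    have h1 : p.ζ * (p.T * ((2 * p.C + 1) ^ 2 + d * (p.C ^ 2 * p.σ ^ 2 * (6 * L)))) =
        p.ζ * (p.T * (2 * p.C + 1) ^ 2) +
          p.ζ * (p.T * (d * (p.C ^ 2 * p.σ ^ 2 * (6 * L)))) := by ring
    rw [h1, e3] at hdiv
    simp only [add_mul]
    linarith
  have hmul : (1 / (2 * a₁) + 5 / (p.C * σ₀) + 5 +
      a₂ * (2 * p.C + 1) ^ 2 / (p.C ^ 2 * σ₀ ^ 2) + 6 * a₂) * (p.C / μ * Q) =
      (1 / (2 * a₁) + 5 / (p.C * σ₀) + 5 +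
      a₂ * (2 * p.C + 1) ^ 2 / (p.C ^ 2 * σ₀ ^ 2) + 6 * a₂) * (p.C * Q) / μ := by ring
  rw [hmul, le_div_iff₀ hμ]
  linarith

end Confidence

/-! ### Elementary estimates -/

/-- Since `3.75 > e`, the logarithm is at least 1. This uniform lower bound supplies `σ₀`, which
absorbs lower-order terms and regularizes the potential. -/
theorem le_sigma {ε δ ε₀ : ℝ} (hε : 0 < ε) (hε₀ : ε ≤ ε₀) (hδ : 0 < δ) (hδ1 : δ ≤ 1) :
    6 / ε₀ ≤ sigma ε δ := by
  have hlog : 1 ≤ Real.log (3.75 / δ) := by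
    rw [Real.le_log_iff_exp_le (by positivity), le_div_iff₀ hδ]
    nlinarith [Real.exp_one_lt_d9, Real.exp_pos 1]
  have hsq : 1 ≤ √(2 * Real.log (3.75 / δ)) := Real.one_le_sqrt.2 (by linarith)
  rw [sigma]
  calc 6 / ε₀ ≤ 6 / ε := by gcongr
    _ ≤ _ := by
        gcongr
        linarith

/-- Deliberately lossy: `σ` is of order `√(log (1/δ)) / ε`, but the square of the regret is linear
in `σ` and is compared with a squared rate, so `log (1/δ) / ε²` is affordable. -/
theorem sigma_le {ε δ ε₀ Δ₀ : ℝ} (hε : 0 < ε) (hε₀ : ε ≤ ε₀) (hδ : 0 < δ) (hΔ₀ : 0 < Δ₀)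
    (hΔ : Δ₀ ≤ Real.log (1 / δ)) :
    sigma ε δ ≤ 6 * ε₀ * (5 / Δ₀ + 2) * (Real.log (1 / δ) / ε ^ 2) := by
  set Δ := Real.log (1 / δ) with hΔdef
  have hlog : Real.log (3.75 / δ) ≤ 2 + Δ := by
    have h1 : (3.75 : ℝ) / δ = 3.75 * (1 / δ) := by ring
    rw [h1, Real.log_mul (by norm_num) (by positivity)]
    have h2 : Real.log 3.75 ≤ 2 := by
      rw [Real.log_le_iff_le_exp (by norm_num)]
      have : Real.exp 2 = Real.exp 1 ^ 2 := by rw [← Real.exp_nat_mul]; norm_num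
      nlinarith [Real.exp_one_gt_d9]
    linarith
  have hsq : √(2 * Real.log (3.75 / δ)) ≤ 5 + 2 * Δ := by
    have hΔ0 : 0 ≤ Δ := hΔ₀.le.trans hΔ
    rw [Real.sqrt_le_left (by positivity)]
    nlinarith
  have hΔ5 : 5 + 2 * Δ ≤ (5 / Δ₀ + 2) * Δ := by
    have : 5 ≤ 5 / Δ₀ * Δ := by
      rw [div_mul_eq_mul_div, le_div_iff₀ hΔ₀]
      linarith
    linarith
  rw [sigma]
  calc _ ≤ 6 * ((5 / Δ₀ + 2) * Δ) / ε := by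
        gcongr
        exact hsq.trans hΔ5
    _ = 6 * ε * (5 / Δ₀ + 2) * (Δ / ε ^ 2) := by field_simp
    _ ≤ _ := by
        have hΔ0 : 0 ≤ Δ := hΔ₀.le.trans hΔ
        gcongr

theorem log_two_mul_div_le {T α A₀ : ℝ} (hT : 1 ≤ T) (hα : 0 < α) (hA₀ : 0 < A₀)
    (hA : A₀ ≤ Real.log (1 / α)) :
    Real.log (2 * T / α) ≤ (1 / A₀ + 1) * (Real.log (1 / α) * (1 + Real.log T)) := by
  set A := Real.log (1 / α)
  have hlT : 0 ≤ Real.log T := Real.log_nonneg hT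
  have h1 : Real.log (2 * T / α) = Real.log 2 + Real.log T + A := by
    have : 2 * T / α = 2 * T * (1 / α) := by ring
    rw [this, Real.log_mul (by positivity) (by positivity), Real.log_mul two_ne_zero (by positivity)]
  have h2 := Real.log_two_lt_d9
  have h3 : 1 ≤ 1 / A₀ * A := by
    rw [div_mul_eq_mul_div, one_mul, le_div_iff₀ hA₀]
    linarith
  rw [h1]
  nlinarith [mul_nonneg (hA₀.le.trans hA) hlT]

theorem one_le_log_two_mul_div {T α : ℝ} (hT : 2 ≤ T) (hα : 0 < α) (hα1 : α ≤ 1) :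
    1 ≤ Real.log (2 * T / α) := by
  rw [Real.le_log_iff_exp_le (by positivity), le_div_iff₀ hα]
  nlinarith [Real.exp_one_lt_d9, Real.exp_pos 1]

theorem log_add_div_le {d T σ₀ : ℝ} (hd : 0 < d) (hdT : d ≤ T) (hT : 1 ≤ T) (hσ₀ : 0 < σ₀) :
    Real.log (d + T / σ₀) ≤ (1 + 1 / σ₀) * (1 + Real.log T) := by
  have hlT : 0 ≤ Real.log T := Real.log_nonneg hT
  have h1 : Real.log (d + T / σ₀) ≤ Real.log (T * (1 + 1 / σ₀)) := by
    refine Real.log_le_log (by positivity) ?_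
    have : T * (1 + 1 / σ₀) = T + T / σ₀ := by ring
    linarith
  rw [Real.log_mul (by positivity) (by positivity)] at h1
  have h2 : Real.log (1 + 1 / σ₀) ≤ 1 / σ₀ := by
    have := Real.log_le_sub_one_of_pos (x := 1 + 1 / σ₀) (by positivity)
    linarith
  have : 0 ≤ 1 / σ₀ * Real.log T := by positivity
  nlinarith

theorem rpow_three_quarters_sq {x : ℝ} (hx : 0 ≤ x) : (x ^ (3 / 4 : ℝ)) ^ 2 = x * √x := by
  rw [← Real.rpow_natCast, ← Real.rpow_mul hx, Real.sqrt_eq_rpow]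
  rcases hx.eq_or_lt with rfl | h
  · norm_num
  · nth_rewrite 2 [← Real.rpow_one x]
    rw [← Real.rpow_add h]
    norm_num

theorem le_rate_of_sq_le {reg K l R Z ε : ℝ} (hK : 0 ≤ K) (hl : 0 ≤ l) (hR : 0 ≤ R) (hZ : 0 ≤ Z)
    (hε : 0 < ε) (h : reg ^ 2 ≤ K ^ 2 * l ^ 2 * R * (Z ^ 2 / ε ^ 2)) :
    reg ≤ K * l ^ 1 * (√R * (Z / ε)) := by
  refine (abs_le_of_sq_le_sq' (h.trans (le_of_eq ?_)) (by positivity)).2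
  rw [pow_one, mul_pow, mul_pow, mul_pow, Real.sq_sqrt hR, div_pow]
  ring

/-- For `T ≥ 2d`, `1 ≤ 2 log (T/d)`, so the factor `log (T/d)` can be inserted at the cost of 2. -/
theorem sq_le_rate_of_two_mul_le {d T L σ ε A Δ A₀ Δ₀ b c kσ kA kl G : ℝ} (hd : 1 ≤ d)
    (hdT : 2 * d ≤ T) (hL0 : 0 ≤ L) (hε : 0 < ε) (hA₀ : 0 < A₀) (hΔ₀ : 0 < Δ₀)
    (hA : A₀ ≤ A) (hΔ : Δ₀ ≤ Δ) (hσ : σ ≤ kσ * (Δ / ε ^ 2))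
    (hL : L ≤ kA * (A * (1 + Real.log T))) (hkσ : 0 ≤ kσ) (hkA : 0 ≤ kA) (hkl : 0 ≤ kl)
    (hc : 0 ≤ c) (hb : b ^ 2 = c * (σ * √(d * T) * L)) :
    (4 * G * b * √(2 * T * d * (kl * (1 + Real.log T)))) ^ 2 ≤
      64 * G ^ 2 * c * kσ * kA * kl * (1 + Real.log T) ^ 2 * (Δ * A * Real.log (T / d)) *
        (((d * T) ^ (3 / 4 : ℝ)) ^ 2 / ε ^ 2) := by
  have hd0 : 0 < d := by linarith
  have hT : 1 ≤ T := by linarith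
  have hT0 : 0 < T := by linarith
  have hlT : 0 ≤ Real.log T := Real.log_nonneg hT
  have hA' : 0 ≤ A := hA₀.le.trans hA
  have hΔ' : 0 ≤ Δ := hΔ₀.le.trans hΔ
  have hlog : 1 ≤ 2 * Real.log (T / d) := by
    have h1 : Real.log 2 ≤ Real.log (T / d) :=
      Real.log_le_log two_pos (by rw [le_div_iff₀ hd0]; exact hdT)
    linarith [Real.log_two_gt_d9]
  rw [rpow_three_quarters_sq (by positivity), mul_pow, mul_pow, mul_pow, hb,
    Real.sq_sqrt (by positivity)]
  set l := 1 + Real.log T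
  have hl0 : 0 ≤ l := by positivity
  set lg := Real.log (T / d)
  calc 4 ^ 2 * G ^ 2 * (c * (σ * √(d * T) * L)) * (2 * T * d * (kl * l))
      ≤ 4 ^ 2 * G ^ 2 * (c * (kσ * (Δ / ε ^ 2) * √(d * T) * (kA * (A * l)))) *
          (2 * T * d * (kl * l)) := by gcongr
    _ = 32 * G ^ 2 * c * kσ * kA * kl * l ^ 2 * (Δ * A) * (d * T * √(d * T) / ε ^ 2) * 1 := by
        ring
    _ ≤ 32 * G ^ 2 * c * kσ * kA * kl * l ^ 2 * (Δ * A) * (d * T * √(d * T) / ε ^ 2) *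
          (2 * lg) := by gcongr
    _ = _ := by ring

/-- Here `log (T/d)` may be tiny, but `d + 1 ≤ T` gives `log (T/d) ≥ 1 - d/T ≥ 1/T`. With `dT ≥
T²/2`, the squared rate is still at least of order `T²`. -/
theorem sq_le_rate_of_lt_two_mul {d T ε ε₀ A Δ A₀ Δ₀ G : ℝ} (hd : 1 ≤ d)
    (hdT : T ≤ 2 * d) (hdT1 : d + 1 ≤ T) (hε : 0 < ε) (hε₀ : ε ≤ ε₀) (hA₀ : 0 < A₀) (hΔ₀ : 0 < Δ₀)
    (hA : A₀ ≤ A) (hΔ : Δ₀ ≤ Δ) :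
    (2 * G * T) ^ 2 ≤
      16 * G ^ 2 * ε₀ ^ 2 / (Δ₀ * A₀) * (1 + Real.log T) ^ 2 * (Δ * A * Real.log (T / d)) *
        (((d * T) ^ (3 / 4 : ℝ)) ^ 2 / ε ^ 2) := by
  have hd0 : 0 < d := by linarith
  have hT : 1 ≤ T := by linarith
  have hT0 : 0 < T := by linarith
  have hl : 1 ≤ (1 + Real.log T) ^ 2 := one_le_pow₀ (by linarith [Real.log_nonneg hT])
  have hε₀' : 0 < ε₀ := hε.trans_le hε₀
  have hlog : 1 / T ≤ Real.log (T / d) := by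
    have h1 := Real.one_sub_inv_le_log_of_pos (x := T / d) (by positivity)
    refine le_trans ?_ h1
    rw [inv_div, div_le_iff₀ hT0, sub_mul, div_mul_cancel₀ _ hT0.ne']
    linarith
  have hlg0 : 0 ≤ Real.log (T / d) := le_trans (by positivity) hlog
  have hroot : T / 2 ≤ √(d * T) := by
    refine Real.le_sqrt_of_sq_le ?_
    nlinarith
  rw [rpow_three_quarters_sq (by positivity)]
  have hA' : 0 < A := hA₀.trans_le hA
  have hΔ' : 0 < Δ := hΔ₀.trans_le hΔ
  set lg := Real.log (T / d)
  calc (2 * G * T) ^ 2 = 16 * G ^ 2 * ε₀ ^ 2 / (Δ₀ * A₀) * 1 * (Δ₀ * A₀ * (1 / T)) *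
        (T / 2 * T * (T / 2) / ε₀ ^ 2) := by
        field_simp
        ring
    _ ≤ 16 * G ^ 2 * ε₀ ^ 2 / (Δ₀ * A₀) * (1 + Real.log T) ^ 2 * (Δ * A * lg) *
        (d * T * √(d * T) / ε ^ 2) := by
        gcongr
        linarith

/-! ### The regret -/

section Regret

variable {d : ℕ} {p : Params d} {θs : Vec d} {h : Transcript d} {η : ℕ → ℝ} {N : Finset (Vec d)}
  {L : ℝ}

/-- The squared width `xₜᵀ (σ₀ I + ∑_{s<t} xₛ xₛᵀ)⁻¹ xₜ` of the action of round `t`. -/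
noncomputable def potential (σ₀ : ℝ) (x : ℕ → Vec d) (t : ℕ) : ℝ :=
  (x t).ofLp ⬝ᵥ ((gram σ₀ x t)⁻¹ *ᵥ (x t).ofLp)

theorem potential_nonneg {σ₀ : ℝ} (hσ₀ : 0 < σ₀) (x : ℕ → Vec d) (t : ℕ) :
    0 ≤ potential σ₀ x t :=
  (posDef_gram hσ₀ x t).inv.posSemidef.dotProduct_mulVec_nonneg (x t).ofLp

theorem sum_sqrt_min_one_potential_le {σ₀ : ℝ} (hσ₀ : 0 < σ₀) (x : ℕ → Vec d) (n : ℕ)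
    (hx : ∀ s < n, ‖x s‖ ≤ 1) :
    ∑ t ∈ Finset.range n, √(min 1 (potential σ₀ x t)) ≤
      √(2 * n * d * Real.log (d + n / σ₀)) := by
  refine Real.le_sqrt_of_sq_le ?_
  have h1 := sq_sum_le_card_mul_sum_sq (s := Finset.range n)
    (f := fun t => √(min 1 (potential σ₀ x t)))
  rw [Finset.card_range] at h1
  refine h1.trans ?_
  have h2 : ∑ t ∈ Finset.range n, √(min 1 (potential σ₀ x t)) ^ 2 ≤
      2 * (d * Real.log (d + n / σ₀)) := by
    refine le_trans ?_ (mul_le_mul_of_nonneg_left (sum_log_one_add_le hσ₀ x n hx) zero_le_two)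
    rw [Finset.mul_sum]
    refine Finset.sum_le_sum fun t _ => ?_
    rw [Real.sq_sqrt (le_min zero_le_one (potential_nonneg hσ₀ x t))]
    exact min_one_le_two_mul_log (potential_nonneg hσ₀ x t)
  calc _ ≤ (n : ℝ) * (2 * (d * Real.log (d + n / σ₀))) := by gcongr
    _ = _ := by ring

/-- Optimism: the regret of a round is at most twice the width of the confidence interval. -/
theorem GoodNoise.inner_sub_inner_le (hgood : GoodNoise p θs N L h η)
    (hN1 : ∀ c ∈ N, ‖c‖ ≤ 1) (hnet : ∀ x : Vec d, ‖x‖ ≤ 1 → ∃ c ∈ N, ‖x - c‖ ≤ 1 / 4)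
    (hL : L = Real.log (2 * p.T / p.α)) (hL1 : 1 ≤ L) (hd1 : 1 ≤ d) {t : ℕ}
    (ht : t ∈ Finset.Ico 1 p.T) (hθ : ‖θs‖ ≤ 1) {σ₀ : ℝ} (hσ₀ : 0 < σ₀) (hσ : σ₀ ≤ p.σ)
    (hb0 : 0 ≤ p.β t)
    (hb : ∑ s ∈ Finset.range p.T, labelError p θs h s ^ 2 + 594 * widthScale p L ≤ p.β t ^ 2)
    {Dt : Set (Vec d)} (hmax : (Vtilde p h t).PosDef → IsMaxOn (ucb p h t) Dt (h.x t))
    {v : Vec d} (hv : v ∈ Dt) :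
    inner ℝ v θs - inner ℝ (h.x t) θs ≤ 2 * p.β t * √(potential σ₀ h.x t) := by
  have hσp : 0 < p.σ := hσ₀.trans_le hσ
  have hL0 : 0 ≤ L := by linarith
  have ht1 := (Finset.mem_Ico.1 ht).1
  have hA := hgood.posDef_Vtilde hN1 hnet hσp hL hL0 hd1 ht
  have hconf := hgood.abs_inner_thetaTilde_sub_le hN1 hnet hσp hL hL1 hd1 ht hθ hb0 hb
  have h1 := (abs_le.1 (hconf v)).1
  have h2 := (abs_le.1 (hconf (h.x t))).2
  have h3 := isMaxOn_iff.1 (hmax hA) v hv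
  rw [ucb, ucb] at h3
  rw [inner_sub_left] at h1 h2
  rw [real_inner_comm θs v, real_inner_comm θs (h.x t)]
  -- Because of the `B_s`, `Ṽ_t` need not increase by rank-one steps; it is compared with the Gram
  -- matrix of constant regularization, for which the potential telescopes.
  have hmat : matNorm (Vtilde p h t)⁻¹ (h.x t) ≤ √(potential σ₀ h.x t) := by
    rw [matNorm, potential]
    refine Real.sqrt_le_sqrt (dotProduct_inv_mulVec_anti hA (posDef_gram hσ₀ h.x t)
      (fun y => ?_) _)
    have h4 := hgood.le_dotProduct_Vtilde_mulVec hN1 hnet hσp hL hL0 hd1 ht (WithLp.toLp 2 y)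
    have h5 := dotProduct_gram_mulVec σ₀ h.x t (WithLp.toLp 2 y)
    have hU : σ₀ ≤ p.upsilon t / 4 := by
      have h6 := (upsilon_pos hσp hL hL0 hd1 ht1).1
      have h7 : 1 ≤ √(t : ℝ) := Real.one_le_sqrt.2 (by exact_mod_cast ht1)
      have h8 : 1 ≤ √(d : ℝ) := Real.one_le_sqrt.2 (by exact_mod_cast hd1)
      have h9 : p.σ * 1 * 1 ≤ p.σ * √(t : ℝ) * √(d : ℝ) := by gcongr
      linarith
    refine h5.le.trans (le_trans ?_ h4)
    gcongr
  have := mul_le_mul_of_nonneg_left hmat hb0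
  linarith

/-- Round 0 is kept apart: `Ṽ_0 = 0` gives no confidence bound, so it contributes the trivial `2G`.
-/
theorem regret_le_of_le {b Y : ℝ} {xs : ℕ → Vec d} {G : ℝ} (hG : 0 ≤ G) (hT : 1 ≤ p.T)
    {f : ℕ → ℝ} (hf0 : ∀ t < p.T, 0 ≤ f t) (hf : ∑ t ∈ Finset.range p.T, f t ≤ Y) (hb : 0 ≤ b)
    (h0 : p.g (inner ℝ (xs 0) θs) - p.g (inner ℝ (h.x 0) θs) ≤ G * 2)
    (hstep : ∀ t ∈ Finset.Ico 1 p.T,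
      p.g (inner ℝ (xs t) θs) - p.g (inner ℝ (h.x t) θs) ≤ G * (b * f t)) :
    regret p θs xs h ≤ G * (2 + b * Y) := by
  have hsplit : regret p θs xs h = (p.g (inner ℝ (xs 0) θs) - p.g (inner ℝ (h.x 0) θs)) +
      ∑ t ∈ Finset.Ico 1 p.T, (p.g (inner ℝ (xs t) θs) - p.g (inner ℝ (h.x t) θs)) := by
    rw [regret, Finset.range_eq_Ico, Finset.sum_eq_sum_Ico_succ_bot (by omega)]
  have hsum : ∑ t ∈ Finset.Ico 1 p.T, f t ≤ Y := by
    refine le_trans (Finset.sum_le_sum_of_subset_of_nonneg ?_ ?_) hf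
    · intro t ht
      exact Finset.mem_range.2 (Finset.mem_Ico.1 ht).2
    · intro t ht _
      exact hf0 t (Finset.mem_range.1 ht)
  have h1 := Finset.sum_le_sum hstep
  rw [← Finset.mul_sum, ← Finset.mul_sum] at h1
  rw [hsplit]
  have h2 : G * (b * ∑ t ∈ Finset.Ico 1 p.T, f t) ≤ G * (b * Y) := by gcongr
  linarith

/-- The regret bound on the good event, before simplification. -/
theorem GoodNoise.regret_le (hgood : GoodNoise p θs N L h η)
    (hN1 : ∀ c ∈ N, ‖c‖ ≤ 1) (hnet : ∀ x : Vec d, ‖x‖ ≤ 1 → ∃ c ∈ N, ‖x - c‖ ≤ 1 / 4)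
    (hL : L = Real.log (2 * p.T / p.α)) (hL1 : 1 ≤ L) (hd1 : 1 ≤ d) (hT : 1 ≤ p.T)
    {G C μ : ℝ} (hG : 0 ≤ G) (hμ : 0 ≤ μ) (hg : IsLink p.g G C μ) (hθ : ‖θs‖ ≤ 1)
    {σ₀ : ℝ} (hσ₀ : 0 < σ₀) (hσ : σ₀ ≤ p.σ) {b : ℝ} (hb1 : 1 ≤ b)
    (hβ0 : ∀ t < p.T, 0 ≤ p.β t) (hβ : ∀ t < p.T, p.β t ≤ b)
    (hconf : ∀ t < p.T,
      ∑ s ∈ Finset.range p.T, labelError p θs h s ^ 2 + 594 * widthScale p L ≤ p.β t ^ 2)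
    {D : ℕ → Set (Vec d)} (hD : ∀ t < p.T, ∀ x ∈ D t, ‖x‖ ≤ 1)
    (hx : ∀ t < p.T, h.x t ∈ D t)
    (hmax : ∀ t < p.T, (Vtilde p h t).PosDef → IsMaxOn (ucb p h t) (D t) (h.x t))
    {xs : ℕ → Vec d} (hxs : ∀ t < p.T, xs t ∈ D t) :
    regret p θs xs h ≤ G * (2 + 2 * b * √(2 * p.T * d * Real.log (d + p.T / σ₀))) := by
  refine regret_le_of_le hG hT (f := fun t => √(min 1 (potential σ₀ h.x t)))
    (fun t _ => Real.sqrt_nonneg _)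
    (sum_sqrt_min_one_potential_le hσ₀ h.x p.T fun s hs => hD s hs _ (hx s hs))
    (by positivity) ?_ ?_
  · have hm1 := inner_mem_Icc (hD 0 hT _ (hxs 0 hT)) hθ
    have hm2 := inner_mem_Icc (hD 0 hT _ (hx 0 hT)) hθ
    exact hg.sub_le hG hμ hm1 hm2 zero_le_two (by linarith [hm1.2, hm2.1])
  · intro t ht
    have htT := (Finset.mem_Ico.1 ht).2
    have hm1 := inner_mem_Icc (hD t htT _ (hxs t htT)) hθ
    have hm2 := inner_mem_Icc (hD t htT _ (hx t htT)) hθ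
    refine hg.sub_le hG hμ hm1 hm2 (by positivity) ?_
    -- Where the truncation is active, the trivial gap 2 is at most `2b` because `1 ≤ b`.
    rcases le_total 1 (potential σ₀ h.x t) with hu | hu
    · rw [min_eq_left hu, Real.sqrt_one]
      linarith [hm1.2, hm2.1]
    · rw [min_eq_right hu]
      refine (hgood.inner_sub_inner_le hN1 hnet hL hL1 hd1 ht hθ hσ₀ hσ (hβ0 t htT)
        (hconf t htT) (hmax t htT) (hxs t htT)).trans ?_
      have := hβ t htT
      gcongr

/-- In the lower constant for the widths, the first five summands cover the label errors, `594 μ /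
C` covers `noiseError`, and `μ / (C σ₀)` ensures that the upper bound for the widths is at least 1.
-/
theorem GoodNoise.regret_le_four_mul (hgood : GoodNoise p θs N L h η)
    (hN1 : ∀ c ∈ N, ‖c‖ ≤ 1) (hnet : ∀ x : Vec d, ‖x‖ ≤ 1 → ∃ c ∈ N, ‖x - c‖ ≤ 1 / 4)
    (hL : L = Real.log (2 * p.T / p.α)) (hL1 : 1 ≤ L) (hd1 : 1 ≤ d) (hdT : d ≤ p.T)
    {G μ σ₀ a₁ a₂ b₁ : ℝ} (hG : 0 ≤ G) (hμ : 0 < μ) (hC : 0 < p.C) (hg : IsLink p.g G p.C μ)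
    (hW : IsClosed p.W) (hWc : Convex ℝ p.W) (hW1 : ∀ θ ∈ p.W, ‖θ‖ ≤ 1) (hθ : θs ∈ p.W)
    (hη : ∀ t < p.T, |η t| ≤ 1) (hy : ∀ t < p.T, h.y t = p.g (inner ℝ (h.x t) θs) + η t)
    (hσ₀ : 0 < σ₀) (hσ : σ₀ ≤ p.σ)
    (ha₁ : 0 < a₁) (ha : a₁ ≤ a₂) (hζ₁ : a₁ / (p.C * p.σ * √((d : ℝ) * p.T)) ≤ p.ζ)
    (hζ₂ : p.ζ ≤ a₂ / (p.C * p.σ * √((d : ℝ) * p.T))) (hβ0 : ∀ t < p.T, 0 ≤ p.β t)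
    (hβ₁ : ∀ t < p.T, (1 / (2 * a₁) + 5 / (p.C * σ₀) + 5 +
      a₂ * (2 * p.C + 1) ^ 2 / (p.C ^ 2 * σ₀ ^ 2) + 6 * a₂ + 594 * μ / p.C + μ / (p.C * σ₀)) *
        (p.C / μ * widthScale p L) ≤ p.β t ^ 2)
    (hβ₂ : ∀ t < p.T, p.β t ^ 2 ≤ b₁ * (p.C / μ * widthScale p L))
    {D : ℕ → Set (Vec d)} (hD : ∀ t < p.T, ∀ x ∈ D t, ‖x‖ ≤ 1)
    (hx : ∀ t < p.T, h.x t ∈ D t)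
    (hmax : ∀ t < p.T, (Vtilde p h t).PosDef → IsMaxOn (ucb p h t) (D t) (h.x t))
    {xs : ℕ → Vec d} (hxs : ∀ t < p.T, xs t ∈ D t) :
    regret p θs xs h ≤ 4 * G * √(b₁ * (p.C / μ * widthScale p L)) *
      √(2 * p.T * d * ((1 + 1 / σ₀) * (1 + Real.log p.T))) := by
  have hT1 : 1 ≤ p.T := hd1.trans hdT
  have ha₂ : 0 < a₂ := ha₁.trans_le ha
  have hd' : (1 : ℝ) ≤ d := by exact_mod_cast hd1
  have hdT' : (d : ℝ) ≤ p.T := by exact_mod_cast hdT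
  have hT' : (1 : ℝ) ≤ p.T := by exact_mod_cast hT1
  have hσp : 0 < p.σ := hσ₀.trans_le hσ
  have hl0 : 0 ≤ Real.log p.T := Real.log_nonneg hT'
  have hroot : 1 ≤ √((d : ℝ) * p.T) := Real.one_le_sqrt.2 (by nlinarith)
  have hQσ : σ₀ ≤ widthScale p L := by
    calc σ₀ = σ₀ * 1 * 1 := by ring
      _ ≤ p.σ * √((d : ℝ) * p.T) * L := by gcongr
  have hS := hgood.sum_labelError_sq_le hC hμ hg hW hWc hW1 hθ (fun t ht => hD t ht _ (hx t ht))
    hη hy hd1 hT1 hL1 hσ₀ hσ ha₁ ha hζ₁ hζ₂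
  have hk₁ : 0 < 1 / (2 * a₁) + 5 / (p.C * σ₀) + 5 +
    a₂ * (2 * p.C + 1) ^ 2 / (p.C ^ 2 * σ₀ ^ 2) + 6 * a₂ := by positivity
  generalize 1 / (2 * a₁) + 5 / (p.C * σ₀) + 5 +
    a₂ * (2 * p.C + 1) ^ 2 / (p.C ^ 2 * σ₀ ^ 2) + 6 * a₂ = k₁ at hS hβ₁ hk₁
  generalize hQ : widthScale p L = Q at hS hβ₁ hβ₂ hQσ ⊢
  have hQ0 : 0 < Q := hσ₀.trans_le hQσ
  have hconf : ∀ t < p.T, ∑ s ∈ Finset.range p.T, labelError p θs h s ^ 2 +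
      594 * widthScale p L ≤ p.β t ^ 2 := by
    intro t ht
    refine le_trans ?_ (hβ₁ t ht)
    have h4 : 594 * Q = 594 * μ / p.C * (p.C / μ * Q) := by field_simp
    have h5 : 0 ≤ μ / (p.C * σ₀) * (p.C / μ * Q) := by positivity
    rw [hQ, h4, add_mul, add_mul]
    linarith
  have hβb : ∀ t < p.T, p.β t ≤ √(b₁ * (p.C / μ * Q)) := fun t ht =>
    Real.le_sqrt_of_sq_le (hβ₂ t ht)
  have hb1 : 1 ≤ √(b₁ * (p.C / μ * Q)) := by
    refine Real.one_le_sqrt.2 (le_trans ?_ ((hβ₁ 0 hT1).trans (hβ₂ 0 hT1)))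
    calc (1 : ℝ) = μ / (p.C * σ₀) * (p.C / μ * σ₀) := by field_simp
      _ ≤ μ / (p.C * σ₀) * (p.C / μ * Q) := by gcongr
      _ ≤ _ := by
        refine mul_le_mul_of_nonneg_right ?_ (by positivity)
        have : 0 ≤ k₁ + 594 * μ / p.C := by positivity
        linarith
  have hreg := hgood.regret_le hN1 hnet hL hL1 hd1 hT1 hG hμ.le hg (hW1 θs hθ) hσ₀ hσ hb1
    hβ0 hβb hconf hD hx hmax hxs
  refine hreg.trans ?_
  generalize √(b₁ * (p.C / μ * Q)) = b at hb1
  have h3 : √(2 * p.T * d * Real.log (d + p.T / σ₀)) ≤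
      √(2 * p.T * d * ((1 + 1 / σ₀) * (1 + Real.log p.T))) := by
    have := log_add_div_le (d := d) (T := p.T) (by linarith) hdT' hT' hσ₀
    gcongr
  have h4 : 1 ≤ √(2 * p.T * d * ((1 + 1 / σ₀) * (1 + Real.log p.T))) := by
    have h0 : 0 ≤ 1 / σ₀ := by positivity
    exact Real.one_le_sqrt.2 (one_le_mul_of_one_le_of_one_le (by nlinarith)
      (one_le_mul_of_one_le_of_one_le (by linarith) (by linarith)))
  generalize √(2 * p.T * d * ((1 + 1 / σ₀) * (1 + Real.log p.T))) = r at h3 h4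
  -- Absorbs the first round: `2 + 2br ≤ 4br`.
  have h8 : 1 ≤ b * r := one_le_mul_of_one_le_of_one_le hb1 h4
  have h9 : b * √(2 * p.T * d * Real.log (d + p.T / σ₀)) ≤ b * r := by gcongr
  calc _ ≤ G * (4 * (b * r)) := by
        refine mul_le_mul_of_nonneg_left ?_ hG
        linarith
    _ = _ := by ring

theorem regret_le_two_mul {G C μ : ℝ} (hG : 0 ≤ G) (hμ : 0 ≤ μ) (hg : IsLink p.g G C μ)
    (hθ : ‖θs‖ ≤ 1) (hx : ∀ t < p.T, ‖h.x t‖ ≤ 1) {xs : ℕ → Vec d} (hxs : ∀ t < p.T, ‖xs t‖ ≤ 1) :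
    regret p θs xs h ≤ 2 * G * p.T := by
  calc regret p θs xs h ≤ ∑ _t ∈ Finset.range p.T, G * 2 := by
        refine Finset.sum_le_sum fun t ht => ?_
        have ht' := Finset.mem_range.1 ht
        have hm1 := inner_mem_Icc (hxs t ht') hθ
        have hm2 := inner_mem_Icc (hx t ht') hθ
        exact hg.sub_le hG hμ hm1 hm2 zero_le_two (by linarith [hm1.2, hm2.1])
    _ = 2 * G * p.T := by
        rw [Finset.sum_const, Finset.card_range, nsmul_eq_mul]
        ring

end Regret

end LDPBandit

/-! ### The main theorem: choice of constants and the two regimes of `T/d` -/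

open LDPBandit in
theorem mainTheorem1 :
    ∃ q : ℕ, ∀ (G C μ ε₀ δ₀ α₀ a₁ a₂ : ℝ), 0 < G → 0 < C → 0 < μ →
      0 < ε₀ → 0 < δ₀ → δ₀ < 1 → 0 < α₀ → α₀ < 1 → 0 < a₁ → a₁ ≤ a₂ →
    ∃ b₀ : ℝ, 0 < b₀ ∧ ∀ b₁ : ℝ, b₀ ≤ b₁ → ∃ K : ℝ, 0 < K ∧
    ∀ (d : ℕ) (p : LDPBandit.Params d),
      1 ≤ d → d < p.T →
      0 < p.ε → p.ε ≤ ε₀ → 0 < p.δ → p.δ ≤ δ₀ → 0 < p.α → p.α ≤ α₀ →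
      p.C = C → LDPBandit.IsLink p.g G C μ →
      IsClosed p.W → Convex ℝ p.W → (∀ θ ∈ p.W, ‖θ‖ ≤ 1) →
      -- step size of exact order `1 / (C σ √(dT))`
      a₁ / (C * p.σ * √((d : ℝ) * p.T)) ≤ p.ζ →
      p.ζ ≤ a₂ / (C * p.σ * √((d : ℝ) * p.T)) →
      -- widths with `β_t²` of order `(C σ / μ) √(dT) log(2T/α)`
      (∀ t < p.T, 0 ≤ p.β t ∧
        b₀ * (C * p.σ / μ * √((d : ℝ) * p.T) * Real.log (2 * p.T / p.α)) ≤ p.β t ^ 2 ∧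
        p.β t ^ 2 ≤ b₁ * (C * p.σ / μ * √((d : ℝ) * p.T) * Real.log (2 * p.T / p.α))) →
    ∀ (θs : LDPBandit.Vec d), θs ∈ p.W →
    ∀ (Ω : Type*) (mΩ : MeasurableSpace Ω) (P : Measure Ω) (_ : IsProbabilityMeasure P)
      (H : Filtration ℕ mΩ) (D : ℕ → Ω → Set (LDPBandit.Vec d))
      (X : Ω → LDPBandit.Transcript d) (η : ℕ → Ω → ℝ),
      LDPBandit.IsRun p θs P H D X η →
    ∀ xs : ℕ → Ω → LDPBandit.Vec d,
      (∀ t < p.T, ∀ ω, xs t ω ∈ D t ω ∧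
        IsMaxOn (fun x => p.g (inner ℝ x θs)) (D t ω) (xs t ω)) →
    ∃ E : Set Ω, MeasurableSet E ∧ 1 - p.α ≤ P.real E ∧ ∀ ω ∈ E,
      LDPBandit.regret p θs (fun t => xs t ω) (X ω) ≤
        K * (1 + Real.log p.T) ^ q *
          (√(Real.log (1 / p.δ) * Real.log (1 / p.α) * Real.log ((p.T : ℝ) / d)) *
            (((d : ℝ) * p.T) ^ (3 / 4 : ℝ) / p.ε)) := by

  refine ⟨1, fun G C μ ε₀ δ₀ α₀ a₁ a₂ hG hC hμ hε₀ hδ₀ hδ₀1 hα₀ hα₀1 ha₁ ha => ?_⟩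
  obtain ⟨σ₀, hσ₀def⟩ : ∃ x, x = 6 / ε₀ := ⟨_, rfl⟩
  have hσ₀ : 0 < σ₀ := by rw [hσ₀def]; positivity
  obtain ⟨Δ₀, hΔ₀def⟩ : ∃ x, x = Real.log (1 / δ₀) := ⟨_, rfl⟩
  have hΔ₀ : 0 < Δ₀ := hΔ₀def ▸ Real.log_pos (by rw [lt_div_iff₀ hδ₀]; linarith)
  obtain ⟨A₀, hA₀def⟩ : ∃ x, x = Real.log (1 / α₀) := ⟨_, rfl⟩
  have hA₀ : 0 < A₀ := hA₀def ▸ Real.log_pos (by rw [lt_div_iff₀ hα₀]; linarith)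
  have ha₂ : 0 < a₂ := ha₁.trans_le ha
  refine ⟨1 / (2 * a₁) + 5 / (C * σ₀) + 5 + a₂ * (2 * C + 1) ^ 2 / (C ^ 2 * σ₀ ^ 2) + 6 * a₂ +
    594 * μ / C + μ / (C * σ₀), by positivity, fun b₁ hb₁ => ?_⟩
  have hb₁0 : 0 < b₁ := lt_of_lt_of_le (by positivity) hb₁
  have hkσ0 : 0 < 6 * ε₀ * (5 / Δ₀ + 2) := by positivity
  have hkA0 : 0 < 1 / A₀ + 1 := by positivity
  have hkl0 : 0 < 1 + 1 / σ₀ := by positivity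
  -- `K₁` and `K₂` are the constants of the squared regret for `2d ≤ T` and `T ≤ 2d`; their sum
  -- serves both, whence `K = √(K₁ + K₂)`.
  obtain ⟨K₁, hK₁⟩ : ∃ x, x = 64 * G ^ 2 * (b₁ * (C / μ)) * (6 * ε₀ * (5 / Δ₀ + 2)) *
    (1 / A₀ + 1) * (1 + 1 / σ₀) := ⟨_, rfl⟩
  obtain ⟨K₂, hK₂⟩ : ∃ x, x = 16 * G ^ 2 * ε₀ ^ 2 / (Δ₀ * A₀) := ⟨_, rfl⟩
  have hK₁0 : 0 < K₁ := by rw [hK₁]; positivity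
  have hK₂0 : 0 < K₂ := by rw [hK₂]; positivity
  refine ⟨√(K₁ + K₂), by positivity, ?_⟩
  intro d p hd hdT hε hεε₀ hδ hδδ₀ hα hαα₀ hpC hg hW hWc hW1 hζ₁ hζ₂ hβ θs hθ Ω mΩ P hP H D X η
    hrun xs hxs
  subst hpC
  have hd' : (1 : ℝ) ≤ d := by exact_mod_cast hd
  have hdT' : (d : ℝ) + 1 ≤ p.T := by exact_mod_cast hdT
  have hT1 : 1 ≤ p.T := by omega
  have hσ : σ₀ ≤ p.σ := hσ₀def ▸ le_sigma hε hεε₀ hδ (by linarith)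
  have hσp : 0 < p.σ := hσ₀.trans_le hσ
  have hΔ : Δ₀ ≤ Real.log (1 / p.δ) := hΔ₀def ▸ Real.log_le_log (by positivity) (by gcongr)
  have hA : A₀ ≤ Real.log (1 / p.α) := hA₀def ▸ Real.log_le_log (by positivity) (by gcongr)
  obtain ⟨N, hN1, hNcard, hnet⟩ := exists_quarter_net d
  obtain ⟨E, hE, hEP, hgood⟩ := hrun.exists_goodNoise hg hW hWc hW1 hθ hd hdT hσp hC hα
    (by linarith) hN1 hNcard
  refine ⟨E, hE, hEP, fun ω hω => ?_⟩
  specialize hgood ω hω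
  have hl0 : 0 ≤ Real.log p.T := Real.log_nonneg (by linarith)
  have hx1 : ∀ t < p.T, ‖(X ω).x t‖ ≤ 1 := fun t ht => hrun.norm_x_le ht ω
  have hxs1 : ∀ t < p.T, ‖xs t ω‖ ≤ 1 := fun t ht =>
    hrun.norm_le_one t ht ω _ (hxs t ht ω).1
  have hlg0 : 0 ≤ Real.log ((p.T : ℝ) / d) :=
    Real.log_nonneg (by rw [le_div_iff₀ (by linarith)]; linarith)
  have hR0 : 0 ≤ Real.log (1 / p.δ) * Real.log (1 / p.α) * Real.log ((p.T : ℝ) / d) :=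
    mul_nonneg (mul_nonneg (hΔ₀.le.trans hΔ) (hA₀.le.trans hA)) hlg0
  suffices hU : ∃ U : ℝ, regret p θs (fun t => xs t ω) (X ω) ≤ U ∧
      U ^ 2 ≤ (K₁ + K₂) * (1 + Real.log p.T) ^ 2 *
        (Real.log (1 / p.δ) * Real.log (1 / p.α) * Real.log ((p.T : ℝ) / d)) *
          ((((d : ℝ) * p.T) ^ (3 / 4 : ℝ)) ^ 2 / p.ε ^ 2) by
    obtain ⟨U, hregU, hU2⟩ := hU
    refine hregU.trans (le_rate_of_sq_le (Real.sqrt_nonneg _) (by positivity) hR0 (by positivity)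
      hε ?_)
    rwa [Real.sq_sqrt (by positivity)]
  have hmono : ∀ k : ℝ, k ≤ K₁ + K₂ → k * (1 + Real.log p.T) ^ 2 *
      (Real.log (1 / p.δ) * Real.log (1 / p.α) * Real.log ((p.T : ℝ) / d)) *
        ((((d : ℝ) * p.T) ^ (3 / 4 : ℝ)) ^ 2 / p.ε ^ 2) ≤ (K₁ + K₂) * (1 + Real.log p.T) ^ 2 *
      (Real.log (1 / p.δ) * Real.log (1 / p.α) * Real.log ((p.T : ℝ) / d)) *
        ((((d : ℝ) * p.T) ^ (3 / 4 : ℝ)) ^ 2 / p.ε ^ 2) := fun k hk =>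
    mul_le_mul_of_nonneg_right (mul_le_mul_of_nonneg_right
      (mul_le_mul_of_nonneg_right hk (sq_nonneg _)) hR0) (by positivity)
  rcases le_total (2 * (d : ℝ)) p.T with h2 | h2
  · have hL1 : 1 ≤ Real.log (2 * p.T / p.α) :=
      one_le_log_two_mul_div (by linarith) hα (by linarith)
    have hform : p.C * p.σ / μ * √((d : ℝ) * p.T) * Real.log (2 * p.T / p.α) =
        p.C / μ * widthScale p (Real.log (2 * p.T / p.α)) := by
      rw [widthScale]
      ring
    simp only [hform] at hβ
    have hreg := hgood.regret_le_four_mul hN1 hnet rfl hL1 hd hdT.le hG.le hμ hC hg hW hWc hW1 hθ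
      (fun t ht => hrun.noise_abs_le t ht ω) (fun t ht => hrun.reward_eq t ht ω) hσ₀ hσ ha₁ ha
      hζ₁ hζ₂ (fun t ht => (hβ t ht).1) (fun t ht => (hβ t ht).2.1) (fun t ht => (hβ t ht).2.2)
      (D := fun t => D t ω) (fun t ht => hrun.norm_le_one t ht ω)
      (fun t ht => hrun.action_mem t ht ω) (fun t ht => hrun.action_max t ht ω)
      (fun t ht => (hxs t ht ω).1)
    refine ⟨_, hreg, ?_⟩
    have hb2 : √(b₁ * (p.C / μ * widthScale p (Real.log (2 * p.T / p.α)))) ^ 2 =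
        b₁ * (p.C / μ) * (p.σ * √((d : ℝ) * p.T) * Real.log (2 * p.T / p.α)) := by
      rw [Real.sq_sqrt (by rw [widthScale]; positivity), widthScale]
      ring
    have hrate := sq_le_rate_of_two_mul_le (G := G) hd' h2 (by linarith) hε hA₀ hΔ₀ hA hΔ
      (sigma_le hε hεε₀ hδ hΔ₀ hΔ) (log_two_mul_div_le (by linarith) hα hA₀ hA) hkσ0.le hkA0.le
      hkl0.le (c := b₁ * (p.C / μ)) (by positivity) hb2
    refine hrate.trans ?_
    rw [← hK₁]
    exact hmono _ (le_add_of_nonneg_right hK₂0.le)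
  · refine ⟨2 * G * p.T, regret_le_two_mul hG.le hμ.le hg (hW1 θs hθ) hx1 hxs1, ?_⟩
    have hrate := sq_le_rate_of_lt_two_mul (G := G) hd' h2 hdT' hε hεε₀ hA₀ hΔ₀ hA hΔ
    refine hrate.trans ?_
    rw [← hK₂]
    exact hmono _ (le_add_of_nonneg_left hK₁0.le)
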